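/- Let $f=\exp(\varphi)$ be a log-concave probability density on $\mathbb{R}$, where $\varphi:\mathbb{R}\to[-\infty,\infty)$ is concave and upper semicontinuous, and let $F$ be its distribution function, with $\{x\in\mathbb{R}: 0<F(x)<1\}=(a_o,b_o)$, $-\infty\le a_o<b_o\le\infty$. Let $X_1,X_2,\ldots$ be independent random variables with density $f$. For $n\ge 2$ let $\hat f_n=\exp(\hat\varphi_n)$ be the log-concave maximum likelihood estimator based on $X_1,\ldots,X_n$: almost surely, $\hat\varphi_n$ maximizes $\sum_{i=1}^n\psi(X_i)$ over all concave functions $\psi:\mathbb{R}\to[-\infty,\infty)$ with $\int e^{\psi(x)}\,dx=1$. Let $X_{(n)}=\max_{i\le n}X_i$, let $\hat\varphi_n'(x+)$ denote the right-sided derivative, with $\hat\varphi_n'(x+):=-\infty$ for $x\ge X_{(n)}$, and let $\varphi'(b_o-):=\lim_{x\uparrow b_o}\varphi'(x+)\in[-\infty,\infty)$. Then, as $n\to\infty$, $$\sup_{x\in\mathbb{R}}\bigl(\hat f_n(x)-f(x)\bigr)^+\to_{\mathrm p}0 .$$ Moreover, for any sequence $(b_n)_n$ in $(a_o,b_o)$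 with limit $b_o$: * if $\varphi'(b_o-)>-\infty$, then $\hat\varphi_n'(b_n+)\le\varphi'(b_o-)+o_{\mathrm p}(1)$, that is, $\mathbb{P}\bigl(\hat\varphi_n'(b_n+)>\varphi'(b_o-)+\varepsilon\bigr)\to0$ for every $\varepsilon>0$; * if $\varphi'(b_o-)=-\infty$, then $\hat\varphi_n'(b_n+)\to_{\mathrm p}-\infty$, that is, $\mathbb{P}\bigl(\hat\varphi_n'(b_n+)\ge M\bigr)\to0$ for every $M\in\mathbb{R}$. -/

import Mathlib

open MeasureTheory ProbabilityTheory Filter Topology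
open scoped ENNReal

namespace LogConcaveTails

/-- Concavity of an extended-real-valued function on the real line.  It is used for functions
with values in `[-∞, ∞)`; for strictly positive weights `-∞` behaves in `EReal` as usual. -/
def IsConcave (g : ℝ → EReal) : Prop :=
  ∀ x y s t : ℝ, 0 < s → 0 < t → s + t = 1 →
    (s : EReal) * g x + (t : EReal) * g y ≤ g (s * x + t * y)

/-- `ψ : ℝ → [-∞, ∞)` is concave and `∫ exp (ψ x) dx = 1`: the logarithm of a log-concave
probability density.  Here `EReal.exp : EReal → ℝ≥0∞`, with `EReal.exp ⊥ = 0`. -/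
structure IsLogConcaveLogDensity (ψ : ℝ → EReal) : Prop where
  lt_top : ∀ x, ψ x < ⊤
  concave : IsConcave ψ
  lintegral_exp : ∫⁻ x, EReal.exp (ψ x) = 1

/-- The probability distribution with density `exp ∘ ψ`. -/
noncomputable def law (ψ : ℝ → EReal) : Measure ℝ :=
  (volume : Measure ℝ).withDensity fun x => EReal.exp (ψ x)

/-- `g` is a log-concave maximum likelihood estimator of the log-density for the data `x`:
it maximizes `∑ i, ψ (x i)` over all concave `ψ : ℝ → [-∞, ∞)` with `∫ exp ψ = 1`. -/
def IsLogConcaveMLE {n : ℕ} (x : Fin n → ℝ) (g : ℝ → EReal) : Prop :=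
  IsLogConcaveLogDensity g ∧
    ∀ ψ : ℝ → EReal, IsLogConcaveLogDensity ψ → ∑ i, ψ (x i) ≤ ∑ i, g (x i)

/-- The set `{x | 0 < F x < 1}`, where `F` is the distribution function of `P`. -/
def cdfSupport (P : Measure ℝ) : Set ℝ :=
  {x | 0 < cdf P x ∧ cdf P x < 1}

/-- The right end point (possibly `∞`) of the interval `{x | 0 < F x < 1}`. -/
noncomputable def rightEnd (P : Measure ℝ) : EReal :=
  sSup (Real.toEReal '' cdfSupport P)

/-- The right-sided derivative `g'(x+)` in `[-∞, ∞]`.  The `limsup` is a limit if `g` is concave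
with values in `[-∞, ∞)`. -/
noncomputable def rightDeriv (g : ℝ → EReal) (x : ℝ) : EReal :=
  limsup (fun y : ℝ => (g y - g x) / ((y - x : ℝ) : EReal)) (𝓝[>] x)

/-- The limit `g'(b-)` of `g'(x+)` as `x` tends to `b ∈ (-∞, ∞]` from below.  The `limsup` is a
limit if `g` is concave and finite on `(a, b)` for some `a < b`, as `g'(x+)` is then
nonincreasing in `x ∈ (a, b)`. -/
noncomputable def derivLeftLim (g : ℝ → EReal) (b : EReal) : EReal :=
  limsup (rightDeriv g) (comap Real.toEReal (𝓝[<] b))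

open scoped Classical in
/-- The right-sided derivative at `t` of an estimated log-density `g` based on the data `x`,
with the convention that it is `-∞` if `t` is at least as large as all data points. -/
noncomputable def estRightDeriv {n : ℕ} (x : Fin n → ℝ) (g : ℝ → EReal) (t : ℝ) : EReal :=
  if ∀ i, x i ≤ t then ⊥ else rightDeriv g t

end LogConcaveTails

namespace LogConcaveTails

open Set

/-! The argument is deterministic. It runs along an arbitrary filter and uses only the facts bundled
in `EmpiricalConvergence`: the empirical distribution functions converge at each point, the
empirical mean of `φ` converges to its mean under the true law, the estimators are maximizers, and
the data lie in the interior of `dom φ`. Randomness enters at the end: `probFilter` turns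
convergence in probability into convergence along a filter, and the law of large numbers supplies
the two limits.

Superlevel sets of concave functions are intervals. A uniform bound for the empirical mass of
intervals therefore gives, by the layer-cake formula, a bound for empirical means of all bounded
quasi-concave functions at once (`integral_empirical_le`). Comparing the likelihood of the estimator
with that of `φ` first bounds the estimator at the data (`IsLogConcaveMLE.data_le`). It then bounds
a Bregman divergence between the truncated estimator `u` and `φ`, the integral of `exp u - f - f *
(u - φ)` (`IsLogConcaveMLE.gap_le`). So on every fixed interval in `dom φ` the estimator eventually
comes close to `φ` at some point (`EmpiricalConvergence.exists_near`), and concavity upgrades this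
to pointwise convergence in the interior of `dom φ`.

The rest is concavity. If a chord of `φ` near the right end has slope below `s`, then so does the
corresponding chord of the estimator, and all its later right derivatives are at most `s`. For the
supremum, upper bounds extrapolate from interior points to neighbourhoods of all points of `closure
(dom φ)` and to the tails. Outside that closure the estimator vanishes, since otherwise restriction
and renormalization would raise the likelihood. Compactness finishes the proof
(`EmpiricalConvergence.eventually_exp_le`). -/

/-! ### Concave functions with values in the extended reals -/

theorem IsConcave.combo_le {g : ℝ → EReal} (hg : IsConcave g) {x y s t a b : ℝ}
    (hs : 0 < s) (ht : 0 < t) (hst : s + t = 1) (ha : (a : EReal) ≤ g x) (hb : (b : EReal) ≤ g y) :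
    ((s * a + t * b : ℝ) : EReal) ≤ g (s * x + t * y) := by
  refine le_trans ?_ (hg x y s t hs ht hst)
  push_cast
  gcongr

/-- Concavity read backwards: a larger value at the far point `x` would lift the value at the
intermediate point above `b`. This is the source of all upper bounds on the estimator below. -/
theorem IsConcave.le_extrapolate {g : ℝ → EReal} (hg : IsConcave g) {c x s t a b : ℝ}
    (hs : 0 < s) (ht : 0 < t) (hst : s + t = 1) (ha : (a : EReal) ≤ g c)
    (hb : g (s * c + t * x) ≤ (b : EReal)) : g x ≤ (((b - s * a) / t : ℝ) : EReal) := by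
  by_contra! h
  obtain ⟨r, hr1, hr2⟩ := EReal.lt_iff_exists_real_btwn.1 h
  have h1 := (hg.combo_le hs ht hst ha hr2.le).trans hb
  rw [EReal.coe_lt_coe_iff, div_lt_iff₀ ht] at hr1
  rw [EReal.coe_le_coe_iff] at h1
  linarith

theorem exists_combo {x y z : ℝ} (h1 : x < z) (h2 : z < y) :
    ∃ s t : ℝ, 0 < s ∧ 0 < t ∧ s + t = 1 ∧ s * x + t * y = z := by
  have h : 0 < y - x := by linarith
  refine ⟨(y - z) / (y - x), (z - x) / (y - x), div_pos (by linarith) h, div_pos (by linarith) h,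
    ?_, ?_⟩
  · field_simp; ring
  · field_simp; ring

theorem IsConcave.comp_neg {g : ℝ → EReal} (hg : IsConcave g) : IsConcave fun x => g (-x) := by
  intro x y s t hs ht hst
  have := hg (-x) (-y) s t hs ht hst
  convert this using 2
  ring

theorem IsConcave.ordConnected_le {g : ℝ → EReal} (hg : IsConcave g) (m : ℝ) :
    OrdConnected {x | (m : EReal) ≤ g x} := by
  refine ⟨fun x hx y hy z hz => ?_⟩
  rcases hz.1.eq_or_lt with rfl | h1
  · exact hx
  rcases hz.2.eq_or_lt with rfl | h2
  · exact hy
  obtain ⟨s, t, hs, ht, hst, rfl⟩ := exists_combo h1 h2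
  have := hg.combo_le hs ht hst hx hy
  rwa [← add_mul, hst, one_mul] at this

/-- The set where a function with values in `[-∞, ∞)` is finite. -/
def dom (g : ℝ → EReal) : Set ℝ := {x | ⊥ < g x}

theorem mem_dom_iff {g : ℝ → EReal} {x : ℝ} : x ∈ dom g ↔ ∃ m : ℝ, (m : EReal) ≤ g x := by
  constructor
  · intro h
    obtain ⟨r, -, hr⟩ := EReal.lt_iff_exists_real_btwn.1 h
    exact ⟨r, hr.le⟩
  · rintro ⟨m, hm⟩
    exact lt_of_lt_of_le (EReal.bot_lt_coe m) hm

theorem notMem_dom_iff {g : ℝ → EReal} {x : ℝ} : x ∉ dom g ↔ g x = ⊥ := by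
  simp [dom]

theorem IsConcave.ordConnected_dom {g : ℝ → EReal} (hg : IsConcave g) : OrdConnected (dom g) := by
  refine ⟨fun x hx y hy z hz => ?_⟩
  obtain ⟨m, hm⟩ := mem_dom_iff.1 hx
  obtain ⟨k, hk⟩ := mem_dom_iff.1 hy
  refine mem_dom_iff.2 ⟨min m k, ?_⟩
  refine (hg.ordConnected_le (min m k)).out ?_ ?_ hz
  · exact le_trans (EReal.coe_le_coe_iff.2 (min_le_left _ _)) hm
  · exact le_trans (EReal.coe_le_coe_iff.2 (min_le_right _ _)) hk

theorem IsConcave.measurable {g : ℝ → EReal} (hg : IsConcave g) (hlt : ∀ x, g x < ⊤) :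
    Measurable g := by
  refine measurable_of_Ici fun m => ?_
  induction m with
  | bot => simp
  | top =>
    have : g ⁻¹' Ici ⊤ = ∅ := by
      ext x; simpa using (hlt x).ne
    rw [this]; exact MeasurableSet.empty
  | coe m => exact (hg.ordConnected_le m).measurableSet

/-- Extrapolation with both levels equal to `m`: once a concave function has dropped to `m`, it
cannot rise again on the far side. -/
theorem IsConcave.le_of_beyond {g : ℝ → EReal} (hg : IsConcave g) {c d x m : ℝ}
    (hc : (m : EReal) ≤ g c) (hd : g d ≤ m) (hcd : c < d ∧ d ≤ x ∨ x ≤ d ∧ d < c) : g x ≤ m := by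
  have key : ∀ s t : ℝ, 0 < s → 0 < t → s + t = 1 → s * c + t * x = d → g x ≤ m := by
    intro s t hs ht hst h
    have := hg.le_extrapolate hs ht hst hc (by rw [h]; exact hd)
    have e : (m - s * m) / t = m := by
      rw [div_eq_iff ht.ne']; rw [← eq_sub_iff_add_eq'] at hst; rw [hst]; ring
    rwa [e] at this
  rcases hcd with ⟨h1, h2⟩ | ⟨h2, h1⟩
  · rcases h2.eq_or_lt with rfl | h2
    · exact hd
    obtain ⟨s, t, hs, ht, hst, h⟩ := exists_combo h1 h2
    exact key s t hs ht hst h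
  · rcases h2.eq_or_lt with rfl | h2
    · exact hd
    obtain ⟨t, s, ht, hs, hst, h⟩ := exists_combo h2 h1
    exact key s t hs ht (by linarith) (by linarith)

theorem Ioo_subset_interior_dom {g : ℝ → EReal} (hg : IsConcave g) {x y : ℝ} (hx : x ∈ dom g)
    (hy : y ∈ dom g) : Ioo x y ⊆ interior (dom g) :=
  interior_maximal (Ioo_subset_Icc_self.trans (hg.ordConnected_dom.out hx hy)) isOpen_Ioo

theorem ordConnected_interior_dom {g : ℝ → EReal} (hg : IsConcave g) :
    OrdConnected (interior (dom g)) :=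
  hg.ordConnected_dom.interior

/-! ### Log-concave densities, their laws and supports -/

theorem IsLogConcaveLogDensity.measurable {φ : ℝ → EReal} (hφ : IsLogConcaveLogDensity φ) :
    Measurable φ :=
  hφ.concave.measurable hφ.lt_top

theorem measurable_exp : Measurable EReal.exp := EReal.exp_monotone.measurable

theorem IsLogConcaveLogDensity.measurable_exp {φ : ℝ → EReal} (hφ : IsLogConcaveLogDensity φ) :
    Measurable fun x => EReal.exp (φ x) :=
  LogConcaveTails.measurable_exp.comp hφ.measurable

theorem IsLogConcaveLogDensity.comp_neg {φ : ℝ → EReal} (hφ : IsLogConcaveLogDensity φ) :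
    IsLogConcaveLogDensity fun x => φ (-x) := by
  refine ⟨fun x => hφ.lt_top _, hφ.concave.comp_neg, ?_⟩
  have := (Measure.measurePreserving_neg (volume : Measure ℝ)).lintegral_comp hφ.measurable_exp
  rw [← hφ.lintegral_exp, ← this]

theorem IsLogConcaveLogDensity.volume_dom_ne_zero {φ : ℝ → EReal} (hφ : IsLogConcaveLogDensity φ) :
    volume (dom φ) ≠ 0 := by
  intro h
  have h1 : (fun x => EReal.exp (φ x)) =ᵐ[volume] 0 := by
    refine measure_mono_null ?_ h
    intro x hx
    simp only [mem_compl_iff, mem_ofPred_eq, Pi.zero_apply, EReal.exp_eq_zero_iff] at hx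
    exact bot_lt_iff_ne_bot.2 hx
  have h2 := lintegral_congr_ae h1
  rw [hφ.lintegral_exp] at h2
  simp at h2

theorem IsLogConcaveLogDensity.exists_lt_dom {φ : ℝ → EReal} (hφ : IsLogConcaveLogDensity φ) :
    ∃ x ∈ dom φ, ∃ y ∈ dom φ, x < y := by
  by_contra! h
  refine hφ.volume_dom_ne_zero (Set.Subsingleton.measure_zero ?_ _)
  intro x hx y hy
  exact le_antisymm (h y hy x hx) (h x hx y hy)

theorem IsLogConcaveLogDensity.interior_dom_nonempty {φ : ℝ → EReal}
    (hφ : IsLogConcaveLogDensity φ) : (interior (dom φ)).Nonempty := by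
  obtain ⟨x, hx, y, hy, hxy⟩ := hφ.exists_lt_dom
  obtain ⟨z, hz⟩ := exists_between hxy
  exact ⟨z, Ioo_subset_interior_dom hφ.concave hx hy hz⟩

theorem coe_toReal_of_mem_dom {φ : ℝ → EReal} (hφ : IsLogConcaveLogDensity φ) {x : ℝ}
    (hx : x ∈ dom φ) : ((φ x).toReal : EReal) = φ x :=
  EReal.coe_toReal (hφ.lt_top x).ne (ne_of_gt hx)

theorem IsLogConcaveLogDensity.isProbabilityMeasure {φ : ℝ → EReal}
    (hφ : IsLogConcaveLogDensity φ) : IsProbabilityMeasure (law φ) :=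
  ⟨by rw [law, withDensity_apply _ MeasurableSet.univ, setLIntegral_univ, hφ.lintegral_exp]⟩

theorem law_absolutelyContinuous (φ : ℝ → EReal) : law φ ≪ volume :=
  withDensity_absolutelyContinuous _ _

theorem law_compl_interior_dom {φ : ℝ → EReal} (hφ : IsLogConcaveLogDensity φ) :
    law φ (interior (dom φ))ᶜ = 0 := by
  have hmeas : MeasurableSet (dom φ) := hφ.concave.ordConnected_dom.measurableSet
  have h1 : law φ (dom φ)ᶜ = 0 := by
    rw [law, withDensity_apply _ hmeas.compl, setLIntegral_eq_zero_iff hmeas.compl hφ.measurable_exp]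
    filter_upwards with x hx
    rw [EReal.exp_eq_zero_iff]
    exact notMem_dom_iff.1 hx
  have h2 : law φ (frontier (dom φ)) = 0 :=
    law_absolutelyContinuous φ (hφ.concave.ordConnected_dom.convex.addHaar_frontier volume)
  refine measure_mono_null ?_ (measure_union_null h1 h2)
  intro x hx
  by_cases hxd : x ∈ dom φ
  · exact Or.inr ⟨subset_closure hxd, hx⟩
  · exact Or.inl hxd

theorem law_pos_of_Ioo_subset {φ : ℝ → EReal} (hφ : IsLogConcaveLogDensity φ) {a b : ℝ}
    (hab : a < b) {s : Set ℝ} (hs : Ioo a b ⊆ s) (hd : Ioo a b ⊆ dom φ) : 0 < law φ s := by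
  refine lt_of_lt_of_le ?_ (measure_mono hs)
  rw [pos_iff_ne_zero, law, withDensity_apply _ measurableSet_Ioo, ne_eq,
    setLIntegral_eq_zero_iff measurableSet_Ioo hφ.measurable_exp]
  intro h
  have : volume (Ioo a b) = 0 := by
    refine measure_mono_null ?_ h
    intro x hx h'
    exact (ne_of_gt (hd hx)) (EReal.exp_eq_zero_iff.1 (h' hx))
  simp at this
  linarith

/-- Points have no mass, so `0 < F x < 1` says that both open half-lines at `x` are charged, which
by convexity means that `dom φ` has points on both sides of `x`. -/
theorem cdfSupport_law {φ : ℝ → EReal} (hφ : IsLogConcaveLogDensity φ) :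
    cdfSupport (law φ) = interior (dom φ) := by
  have := hφ.isProbabilityMeasure
  have hzero : ∀ s, s ⊆ (dom φ)ᶜ → law φ s = 0 := fun s hs =>
    measure_mono_null (hs.trans (compl_subset_compl.2 interior_subset)) (law_compl_interior_dom hφ)
  have hIoi : ∀ x, law φ (Ioi x) = 0 ↔ cdf (law φ) x = 1 := by
    intro x
    rw [cdf_eq_real, ← compl_Iic, ← measureReal_eq_zero_iff, probReal_compl_eq_one_sub measurableSet_Iic]
    constructor <;> intro h <;> linarith
  ext x
  constructor
  · rintro ⟨h1, h2⟩
    rw [cdf_eq_real, measureReal_def, ENNReal.toReal_pos_iff] at h1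
    have h3 : law φ (Iio x) ≠ 0 := by
      intro h
      have : law φ (Iic x) = 0 := by
        rw [← Iio_union_right]
        exact measure_union_null h (law_absolutelyContinuous φ (by simp))
      exact h1.1.ne' this
    have h4 : law φ (Ioi x) ≠ 0 := fun h => h2.ne ((hIoi x).1 h)
    have h5 : ∃ y ∈ dom φ, y < x := by
      by_contra! h
      exact h3 (hzero _ fun y hy hyd => absurd (h y hyd) (not_le.2 hy))
    have h6 : ∃ y ∈ dom φ, x < y := by
      by_contra! h
      exact h4 (hzero _ fun y hy hyd => absurd (h y hyd) (not_le.2 hy))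
    obtain ⟨y, hy, hyx⟩ := h5
    obtain ⟨z, hz, hxz⟩ := h6
    exact Ioo_subset_interior_dom hφ.concave hy hz ⟨hyx, hxz⟩
  · intro hx
    obtain ⟨a, b, hab, hsub⟩ := mem_nhds_iff_exists_Ioo_subset.1 (mem_interior_iff_mem_nhds.1 hx)
    have hl : 0 < law φ (Iic x) := law_pos_of_Ioo_subset hφ hab.1 (fun y hy => hy.2.le)
      ((Ioo_subset_Ioo_right hab.2.le).trans hsub)
    have hr : 0 < law φ (Ioi x) := law_pos_of_Ioo_subset hφ hab.2 (fun y hy => hy.1)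
      ((Ioo_subset_Ioo_left hab.1.le).trans hsub)
    refine ⟨?_, lt_of_le_of_ne (cdf_le_one _ _) fun h => hr.ne' ((hIoi x).2 h)⟩
    rw [cdf_eq_real]
    exact ENNReal.toReal_pos hl.ne' (measure_ne_top _ _)

/-! ### Exponential tails and integrability of the log-density -/

theorem IsLogConcaveLogDensity.exists_gt_lt {φ : ℝ → EReal} (hφ : IsLogConcaveLogDensity φ)
    {x m : ℝ} : ∃ y, x < y ∧ φ y < m := by
  by_contra! h
  have h1 : ∫⁻ y in Ioi x, EReal.exp (m : EReal) ≤ 1 := by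
    rw [← hφ.lintegral_exp]
    refine (setLIntegral_mono' measurableSet_Ioi fun y hy => ?_).trans (setLIntegral_le_lintegral _ _)
    exact EReal.exp_monotone (h y hy)
  rw [setLIntegral_const, Real.volume_Ioi, ENNReal.mul_top] at h1
  · simp at h1
  · simp [Real.exp_pos]

/-- Finite total mass forces a strict drop somewhere to the right of a point of finiteness; beyond
the drop, the falling line through these two levels dominates. -/
theorem IsLogConcaveLogDensity.exists_right_bound {φ : ℝ → EReal} (hφ : IsLogConcaveLogDensity φ) :
    ∃ T α β : ℝ, 0 < β ∧ ∀ x, T ≤ x → φ x ≤ ((α - β * x : ℝ) : EReal) := by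
  obtain ⟨x₀, hx₀⟩ := hφ.interior_dom_nonempty
  obtain ⟨m, hm⟩ := mem_dom_iff.1 (interior_subset hx₀)
  obtain ⟨x₁, hx, hx₁⟩ := hφ.exists_gt_lt (x := x₀) (m := m)
  obtain ⟨k, hk1, hk2⟩ := EReal.lt_iff_exists_real_btwn.1 hx₁
  rw [EReal.coe_lt_coe_iff] at hk2
  -- The line through `(x₀, m)` and `(x₁, k)`. Starting at `x₁ + 1` keeps the extrapolation weight
  -- of `x₀` strictly positive.
  refine ⟨x₁ + 1, m + (m - k) / (x₁ - x₀) * x₀, (m - k) / (x₁ - x₀),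
    div_pos (by linarith) (by linarith), fun x hxT => ?_⟩
  have h1 : 0 < x - x₀ := by linarith
  have h2 : 0 < x₁ - x₀ := by linarith
  have h3 := hφ.concave.le_extrapolate (c := x₀) (x := x) (s := (x - x₁) / (x - x₀))
    (t := (x₁ - x₀) / (x - x₀)) (a := m) (b := k) (div_pos (by linarith) h1) (div_pos h2 h1)
    (by field_simp; ring) hm (by
      have : (x - x₁) / (x - x₀) * x₀ + (x₁ - x₀) / (x - x₀) * x = x₁ := by field_simp; ring
      rw [this]; exact hk1.le)
  convert h3 using 2
  field_simp
  ring

theorem IsLogConcaveLogDensity.exists_exp_bound {φ : ℝ → EReal} (hφ : IsLogConcaveLogDensity φ)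
    (husc : UpperSemicontinuous φ) :
    ∃ α β : ℝ, 0 < β ∧ ∀ x, φ x ≤ ((α - β * |x| : ℝ) : EReal) := by
  obtain ⟨T₁, α₁, β₁, hβ₁, h₁⟩ := hφ.exists_right_bound
  obtain ⟨T₂, α₂, β₂, hβ₂, h₂⟩ := hφ.comp_neg.exists_right_bound
  set T := max (max T₁ T₂) 0 with hT
  have hT0 : 0 ≤ T := le_max_right _ _
  have hT1 : T₁ ≤ T := (le_max_left _ _).trans (le_max_left _ _)
  have hT2 : T₂ ≤ T := (le_max_right _ _).trans (le_max_left _ _)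
  obtain ⟨z, -, hz⟩ := (husc.upperSemicontinuousOn (Icc (-T) T)).exists_isMaxOn
    ⟨0, by simpa using hT0⟩ isCompact_Icc
  obtain ⟨C, hC1, -⟩ := EReal.lt_iff_exists_real_btwn.1 (hφ.lt_top z)
  set β := min β₁ β₂ with hβ
  have hβ0 : 0 < β := lt_min hβ₁ hβ₂
  refine ⟨max (max α₁ α₂) (C + β * T), β, hβ0, fun x => ?_⟩
  by_cases hx : |x| ≤ T
  · refine (hz (show x ∈ Icc (-T) T from abs_le.1 hx)).trans (hC1.le.trans ?_)
    rw [EReal.coe_le_coe_iff]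
    have : β * |x| ≤ β * T := by gcongr
    linarith [le_max_right (max α₁ α₂) (C + β * T)]
  push Not at hx
  have hm := le_max_left (max α₁ α₂) (C + β * T)
  rcases le_or_gt 0 x with h0 | h0
  · rw [abs_of_nonneg h0] at hx ⊢
    refine (h₁ x (by linarith)).trans ?_
    rw [EReal.coe_le_coe_iff]
    have : β * x ≤ β₁ * x := by gcongr; exact min_le_left _ _
    linarith [le_max_left α₁ α₂]
  · rw [abs_of_neg h0] at hx ⊢
    have := h₂ (-x) (by linarith)
    rw [neg_neg] at this
    refine this.trans ?_
    rw [EReal.coe_le_coe_iff]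
    have : β * (-x) ≤ β₂ * (-x) := by
      have : 0 ≤ -x := by linarith
      gcongr; exact min_le_right _ _
    linarith [le_max_right α₁ α₂]

/-- The real-valued density with logarithm `φ`. -/
noncomputable def dens (φ : ℝ → EReal) (x : ℝ) : ℝ := (EReal.exp (φ x)).toReal

theorem dens_nonneg (φ : ℝ → EReal) (x : ℝ) : 0 ≤ dens φ x := ENNReal.toReal_nonneg

theorem dens_of_notMem {φ : ℝ → EReal} {x : ℝ} (hx : x ∉ dom φ) : dens φ x = 0 := by
  rw [dens, notMem_dom_iff.1 hx]; simp

theorem dens_of_eq_coe {φ : ℝ → EReal} {x r : ℝ} (h : φ x = r) : dens φ x = Real.exp r := by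
  rw [dens, h, EReal.exp_coe, ENNReal.toReal_ofReal (Real.exp_pos r).le]

theorem IsLogConcaveLogDensity.dens_of_mem {φ : ℝ → EReal} (hφ : IsLogConcaveLogDensity φ) {x : ℝ}
    (hx : x ∈ dom φ) : dens φ x = Real.exp (φ x).toReal :=
  dens_of_eq_coe (coe_toReal_of_mem_dom hφ hx).symm

theorem IsLogConcaveLogDensity.measurable_dens {φ : ℝ → EReal} (hφ : IsLogConcaveLogDensity φ) :
    Measurable (dens φ) := hφ.measurable_exp.ennreal_toReal

theorem IsLogConcaveLogDensity.exp_lt_top {φ : ℝ → EReal} (hφ : IsLogConcaveLogDensity φ) (x : ℝ) :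
    EReal.exp (φ x) < ⊤ := EReal.exp_lt_top_iff.2 (hφ.lt_top x)

theorem IsLogConcaveLogDensity.integrable_dens {φ : ℝ → EReal} (hφ : IsLogConcaveLogDensity φ) :
    Integrable (dens φ) :=
  integrable_toReal_of_lintegral_ne_top hφ.measurable_exp.aemeasurable (by simp [hφ.lintegral_exp])

theorem IsLogConcaveLogDensity.integral_dens {φ : ℝ → EReal} (hφ : IsLogConcaveLogDensity φ) :
    ∫ x, dens φ x = 1 := by
  unfold dens
  rw [integral_toReal hφ.measurable_exp.aemeasurable (ae_of_all _ hφ.exp_lt_top), hφ.lintegral_exp]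
  rfl

theorem IsLogConcaveLogDensity.setIntegral_law {φ : ℝ → EReal} (hφ : IsLogConcaveLogDensity φ)
    (h : ℝ → ℝ) {s : Set ℝ} (hs : MeasurableSet s) :
    ∫ x in s, h x ∂(law φ) = ∫ x in s, dens φ x * h x := by
  rw [law, restrict_withDensity hs, integral_withDensity_eq_integral_toReal_smul hφ.measurable_exp
    (ae_of_all _ hφ.exp_lt_top)]
  rfl

theorem IsLogConcaveLogDensity.integrable_law_iff {φ : ℝ → EReal} (hφ : IsLogConcaveLogDensity φ)
    (h : ℝ → ℝ) : Integrable h (law φ) ↔ Integrable fun x => dens φ x * h x := by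
  rw [law, integrable_withDensity_iff_integrable_smul' hφ.measurable_exp
    (ae_of_all _ hφ.exp_lt_top)]
  rfl

theorem integrable_exp_neg_mul_abs {β : ℝ} (hβ : 0 < β) :
    Integrable fun x : ℝ => Real.exp (-β * |x|) := by
  have h1 : IntegrableOn (fun x : ℝ => Real.exp (-β * |x|)) (Ioi 0) := by
    refine (integrableOn_exp_mul_Ioi (a := -β) (by linarith) 0).congr_fun ?_ measurableSet_Ioi
    intro x hx
    simp only [abs_of_pos (mem_Ioi.1 hx)]
  have h2 : IntegrableOn (fun x : ℝ => Real.exp (-β * |x|)) (Iic 0) := by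
    refine (integrableOn_exp_mul_Iic hβ 0).congr_fun ?_ measurableSet_Iic
    intro x hx
    simp only [abs_of_nonpos (mem_Iic.1 hx), mul_neg, neg_mul, neg_neg]
  rw [← integrableOn_univ, ← Iic_union_Ioi (a := (0 : ℝ))]
  exact h2.union h1

/-- Half of the exponent absorbs the factor `|t|`; the other half remains integrable when `t` is at
most `α - β * |x|`. -/
theorem abs_mul_exp_le {t C : ℝ} (h : t ≤ C) :
    Real.exp t * |t| ≤ (2 + 2 * |C| * Real.exp (|C| / 2)) * Real.exp (t / 2) := by
  have e : Real.exp t = Real.exp (t / 2) * Real.exp (t / 2) := by rw [← Real.exp_add]; ring_nf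
  have hp := Real.exp_pos (t / 2)
  have key : Real.exp (t / 2) * |t| ≤ 2 + 2 * |C| * Real.exp (|C| / 2) := by
    rcases le_or_gt 0 t with h0 | h0
    · rw [abs_of_nonneg h0]
      have h1 : t ≤ |C| := h.trans (le_abs_self C)
      have h2 : Real.exp (t / 2) ≤ Real.exp (|C| / 2) := Real.exp_le_exp.2 (by linarith)
      have h3 : Real.exp (t / 2) * t ≤ Real.exp (|C| / 2) * |C| := by gcongr
      nlinarith [abs_nonneg C, Real.exp_pos (|C| / 2)]
    · rw [abs_of_neg h0]
      have h1 : -t / 2 ≤ Real.exp (-t / 2) := by linarith [Real.add_one_le_exp (-t / 2)]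
      have h2 : Real.exp (t / 2) * Real.exp (-t / 2) = 1 := by rw [← Real.exp_add]; simp [neg_div]
      have h3 : 0 ≤ 2 * |C| * Real.exp (|C| / 2) := by positivity
      nlinarith
  rw [e, mul_assoc, mul_comm (2 + _)]
  exact mul_le_mul_of_nonneg_left key hp.le

theorem IsLogConcaveLogDensity.integrable_toReal {φ : ℝ → EReal} (hφ : IsLogConcaveLogDensity φ)
    (husc : UpperSemicontinuous φ) : Integrable (fun x => (φ x).toReal) (law φ) := by
  obtain ⟨α, β, hβ, h⟩ := hφ.exists_exp_bound husc
  rw [hφ.integrable_law_iff]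
  have hm : Measurable fun x => dens φ x * (φ x).toReal :=
    hφ.measurable_dens.mul hφ.measurable.ereal_toReal
  refine (((integrable_exp_neg_mul_abs (half_pos hβ)).const_mul
    ((2 + 2 * |α| * Real.exp (|α| / 2)) * Real.exp (α / 2)))).mono' hm.aestronglyMeasurable ?_
  filter_upwards with x
  by_cases hx : x ∈ dom φ
  · rw [hφ.dens_of_mem hx, norm_mul, Real.norm_eq_abs, Real.norm_eq_abs, abs_of_pos (Real.exp_pos _)]
    have h1 : (φ x).toReal ≤ α - β * |x| := by
      rw [← EReal.coe_le_coe_iff, coe_toReal_of_mem_dom hφ hx]; exact h x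
    have h2 : (φ x).toReal ≤ α := h1.trans (by linarith [mul_nonneg hβ.le (abs_nonneg x)])
    refine (abs_mul_exp_le h2).trans ?_
    rw [mul_assoc _ (Real.exp (α / 2)), ← Real.exp_add]
    gcongr
    linarith
  · rw [dens_of_notMem hx]
    simp only [zero_mul, norm_zero]
    positivity

/-! ### Empirical distributions, uniformly over intervals -/

/-- The empirical distribution of the data `x`. -/
noncomputable def empirical {n : ℕ} (x : Fin n → ℝ) : Measure ℝ :=
  (n : ℝ≥0∞)⁻¹ • ∑ j, Measure.dirac (x j)

theorem integral_empirical {n : ℕ} (x : Fin n → ℝ) (h : ℝ → ℝ) :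
    ∫ y, h y ∂(empirical x) = (∑ j, h (x j)) / n := by
  rw [empirical, integral_smul_measure, integral_finsetSum_measure]
  · simp [div_eq_inv_mul]
  · intro j _
    exact integrable_dirac (by simp)

theorem isProbabilityMeasure_empirical {n : ℕ} (x : Fin n → ℝ) (hn : n ≠ 0) :
    IsProbabilityMeasure (empirical x) := by
  refine ⟨?_⟩
  simp only [empirical, Measure.smul_apply, Measure.finsetSum_apply, measure_univ, smul_eq_mul,
    Finset.sum_const, Finset.card_univ, Fintype.card_fin, nsmul_eq_mul, mul_one]
  exact ENNReal.inv_mul_cancel (by simpa using hn) (by simp)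

theorem empirical_real_mono_of_data {n : ℕ} (x : Fin n → ℝ) (hn : n ≠ 0) {s t : Set ℝ}
    (hs : MeasurableSet s) (ht : MeasurableSet t) (h : ∀ j, x j ∈ s → x j ∈ t) :
    (empirical x).real s ≤ (empirical x).real t := by
  have := isProbabilityMeasure_empirical x hn
  rw [measureReal_def, measureReal_def]
  refine ENNReal.toReal_mono (measure_ne_top _ _) ?_
  simp only [empirical, Measure.smul_apply, Measure.finsetSum_apply, smul_eq_mul]
  refine mul_le_mul_right (Finset.sum_le_sum fun j _ => ?_) _
  rw [Measure.dirac_apply' _ hs, Measure.dirac_apply' _ ht]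
  by_cases hj : x j ∈ s
  · simp [hj, h j hj]
  · simp [hj]

theorem continuous_cdf (P : Measure ℝ) [IsProbabilityMeasure P] [NullSingletonClass P] :
    Continuous (cdf P) := by
  rw [continuous_iff_continuousAt]
  intro a
  have h1 : Function.leftLim (cdf P) a = cdf P a := by
    have h2 := StieltjesFunction.measure_singleton (cdf P) a
    rw [measure_cdf, measure_singleton] at h2
    have h3 : cdf P a - Function.leftLim (cdf P) a ≤ 0 := ENNReal.ofReal_eq_zero.1 h2.symm
    have h4 := (monotone_cdf P).leftLim_le (le_refl a)
    linarith
  rw [(monotone_cdf P).continuousAt_iff_leftLim_eq_rightLim, h1, StieltjesFunction.rightLim_eq]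

/-- The grid consists of quantiles at the levels `j / N` with `1 / N ≤ κ`; they exist because the
distribution function is continuous. -/
theorem exists_finset_grid (P : Measure ℝ) [IsProbabilityMeasure P] [NullSingletonClass P] {κ : ℝ}
    (hκ : 0 < κ) : ∃ Q : Finset ℝ, ∀ a,
      (cdf P a ≤ κ ∨ ∃ q ∈ Q, q < a ∧ cdf P a ≤ cdf P q + κ) ∧
      (1 ≤ cdf P a + κ ∨ ∃ q ∈ Q, a ≤ q ∧ cdf P q ≤ cdf P a + κ) := by
  obtain ⟨N, hN⟩ := exists_nat_gt (1 / κ)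
  have hN0 : (0 : ℝ) < N := lt_trans (by positivity) hN
  have hNκ : 1 / (N : ℝ) ≤ κ := by
    rw [div_le_iff₀ hN0]; rw [div_lt_iff₀ hκ] at hN; linarith
  have hex : ∀ j : ℕ, ∃ q, 0 < j → j < N → cdf P q = j / N := by
    intro j
    by_cases hj : 0 < j ∧ j < N
    · have h1 : (0 : ℝ) < j / N := div_pos (by exact_mod_cast hj.1) hN0
      have h2 : (j : ℝ) / N < 1 := by rw [div_lt_one hN0]; exact_mod_cast hj.2
      obtain ⟨q, hq⟩ := mem_range_of_exists_le_of_exists_ge (continuous_cdf P)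
        ((tendsto_cdf_atBot P).eventually_le_const h1).exists
        ((tendsto_cdf_atTop P).eventually_const_le h2).exists
      exact ⟨q, fun _ _ => hq⟩
    · exact ⟨0, fun h1 h2 => absurd ⟨h1, h2⟩ hj⟩
  choose q hq using hex
  refine ⟨(Finset.range N).image q, fun a => ⟨?_, ?_⟩⟩
  · by_cases h0 : cdf P a ≤ κ
    · exact Or.inl h0
    right
    push Not at h0
    -- Here `j` is the largest integer strictly below `N * F a`, which makes `q j < a` strict, so
    -- that `Iic (q j)` lies in `Iio a`.
    obtain ⟨j, hj⟩ : ∃ j, ⌈(N : ℝ) * cdf P a⌉₊ = j + 1 := Nat.exists_eq_succ_of_ne_zero (by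
      have : 0 < ⌈(N : ℝ) * cdf P a⌉₊ := Nat.ceil_pos.2 (mul_pos hN0 (hκ.trans h0))
      omega)
    have h1 : (j : ℝ) < N * cdf P a := Nat.lt_ceil.1 (by omega)
    have h2 : (N : ℝ) * cdf P a ≤ j + 1 := by
      have := Nat.le_ceil ((N : ℝ) * cdf P a); rw [hj] at this; exact_mod_cast this
    have hjN : j < N := by
      have : (j : ℝ) < N := h1.trans_le (mul_le_of_le_one_right hN0.le (cdf_le_one _ _))
      exact_mod_cast this
    have hj0 : 0 < j := by
      by_contra! h
      interval_cases j
      have : cdf P a ≤ 1 / N := by rw [le_div_iff₀ hN0]; simpa [mul_comm] using h2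
      linarith
    have hqj := hq j hj0 hjN
    refine ⟨q j, Finset.mem_image_of_mem _ (Finset.mem_range.2 hjN), ?_, ?_⟩
    · by_contra! h
      have := monotone_cdf P h
      rw [hqj, le_div_iff₀ hN0] at this
      linarith
    · rw [hqj]
      have : cdf P a ≤ (j + 1) / N := by rw [le_div_iff₀ hN0]; linarith
      rw [add_div] at this
      linarith
  · by_cases h0 : 1 ≤ cdf P a + κ
    · exact Or.inl h0
    right
    push Not at h0
    set j := ⌊(N : ℝ) * cdf P a⌋₊ + 1 with hj
    have hnn : 0 ≤ (N : ℝ) * cdf P a := mul_nonneg hN0.le (cdf_nonneg _ _)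
    have h1 : (N : ℝ) * cdf P a < j := by
      have := Nat.lt_floor_add_one ((N : ℝ) * cdf P a); rw [hj]; exact_mod_cast this
    have h2 : (j : ℝ) ≤ N * cdf P a + 1 := by
      have := Nat.floor_le hnn; rw [hj]; push_cast; linarith
    have h3 : (j : ℝ) / N ≤ cdf P a + κ := by
      have : (j : ℝ) / N ≤ (N * cdf P a + 1) / N := by gcongr
      rw [add_div, mul_div_cancel_left₀ _ hN0.ne'] at this
      linarith
    have hjN : j < N := by
      have : (j : ℝ) < N := by
        have := h3.trans_lt h0
        rwa [div_lt_one hN0] at this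
      exact_mod_cast this
    have hqj := hq j (by omega) hjN
    refine ⟨q j, Finset.mem_image_of_mem _ (Finset.mem_range.2 hjN), ?_, by rw [hqj]; exact h3⟩
    by_contra! h
    have := monotone_cdf P h.le
    rw [hqj, div_le_iff₀ hN0] at this
    linarith

/-- One-sided Glivenko–Cantelli. Each end point of the interval costs `κ / 4` for moving to the grid
and `κ / 4` for convergence on the grid. -/
theorem eventually_empirical_Icc_le {ι : Type*} {l : Filter ι} {N : ι → ℕ}
    {x : ∀ i, Fin (N i) → ℝ} (P : Measure ℝ) [IsProbabilityMeasure P] [NullSingletonClass P]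
    (hN : ∀ᶠ i in l, N i ≠ 0)
    (h : ∀ q, Tendsto (fun i => (empirical (x i)).real (Iic q)) l (𝓝 (P.real (Iic q))))
    {κ : ℝ} (hκ : 0 < κ) :
    ∀ᶠ i in l, ∀ a b, a ≤ b → (empirical (x i)).real (Icc a b) ≤ P.real (Icc a b) + κ := by
  obtain ⟨Q, hQ⟩ := exists_finset_grid P (κ := κ / 4) (by linarith)
  have hev : ∀ᶠ i in l, ∀ q ∈ Q, |(empirical (x i)).real (Iic q) - cdf P q| < κ / 4 := by
    rw [Filter.eventually_all_finset]
    intro q _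
    have := (Metric.tendsto_nhds.1 (h q)) (κ / 4) (by linarith)
    simpa only [Real.dist_eq, cdf_eq_real] using this
  filter_upwards [hev, hN] with i hi hNi a b hab
  have := isProbabilityMeasure_empirical (x i) hNi
  have e1 : ∀ (R : Measure ℝ) [IsProbabilityMeasure R],
      R.real (Icc a b) = R.real (Iic b) - R.real (Iio a) := by
    intro R _
    have hsub : Iio a ⊆ Iic b := fun y hy => (le_of_lt hy).trans hab
    rw [← measureReal_sdiff hsub measurableSet_Iio]
    congr 1
    ext y
    simp
  have e2 : P.real (Iio a) = cdf P a := by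
    rw [cdf_eq_real, measureReal_def, measureReal_def, measure_congr Iio_ae_eq_Iic]
  rw [e1, e1 P, e2, ← cdf_eq_real P b]
  have h1 : cdf P a - κ / 2 ≤ (empirical (x i)).real (Iio a) := by
    rcases (hQ a).1 with h0 | ⟨q, hq, hqa, hc⟩
    · have : 0 ≤ (empirical (x i)).real (Iio a) := measureReal_nonneg
      linarith
    · have h2 := abs_lt.1 (hi q hq)
      have h3 : (empirical (x i)).real (Iic q) ≤ (empirical (x i)).real (Iio a) :=
        measureReal_mono fun y hy => lt_of_le_of_lt hy hqa
      linarith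
  have h2 : (empirical (x i)).real (Iic b) ≤ cdf P b + κ / 2 := by
    rcases (hQ b).2 with h0 | ⟨q, hq, hqa, hc⟩
    · have : (empirical (x i)).real (Iic b) ≤ 1 := measureReal_le_one
      linarith
    · have h2 := abs_lt.1 (hi q hq)
      have h3 : (empirical (x i)).real (Iic b) ≤ (empirical (x i)).real (Iic q) :=
        measureReal_mono fun y hy => le_trans hy hqa
      linarith
  linarith

/-- Only the data matter for the empirical mass, so `I` may be shrunk to the closed interval spanned
by the extreme data points it contains. -/
theorem eventually_empirical_ordConnected_le {ι : Type*} {l : Filter ι} {N : ι → ℕ}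
    {x : ∀ i, Fin (N i) → ℝ} (P : Measure ℝ) [IsProbabilityMeasure P] [NullSingletonClass P]
    (hN : ∀ᶠ i in l, N i ≠ 0)
    (h : ∀ q, Tendsto (fun i => (empirical (x i)).real (Iic q)) l (𝓝 (P.real (Iic q))))
    {κ : ℝ} (hκ : 0 < κ) :
    ∀ᶠ i in l, ∀ I : Set ℝ, OrdConnected I → (empirical (x i)).real I ≤ P.real I + κ := by
  filter_upwards [eventually_empirical_Icc_le P hN h hκ, hN] with i hi hNi I hI
  classical
  rcases (Finset.univ.filter fun j => x i j ∈ I).eq_empty_or_nonempty with he | hne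
  · have h0 : (empirical (x i)).real I ≤ (empirical (x i)).real ∅ := by
      refine empirical_real_mono_of_data _ hNi hI.measurableSet MeasurableSet.empty fun j hj => ?_
      have hj' : j ∈ Finset.univ.filter fun j => x i j ∈ I :=
        Finset.mem_filter.2 ⟨Finset.mem_univ j, hj⟩
      rw [he] at hj'
      exact absurd hj' (Finset.notMem_empty j)
    rw [measureReal_empty] at h0
    have : 0 ≤ P.real I := measureReal_nonneg
    linarith
  · obtain ⟨j₁, hj₁, hmin⟩ := Finset.exists_min_image _ (x i) hne
    obtain ⟨j₂, hj₂, hmax⟩ := Finset.exists_max_image _ (x i) hne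
    have hsub : Icc (x i j₁) (x i j₂) ⊆ I :=
      hI.out (Finset.mem_filter.1 hj₁).2 (Finset.mem_filter.1 hj₂).2
    calc (empirical (x i)).real I ≤ (empirical (x i)).real (Icc (x i j₁) (x i j₂)) := by
          refine empirical_real_mono_of_data _ hNi hI.measurableSet measurableSet_Icc fun j hj => ?_
          have : j ∈ Finset.univ.filter fun j => x i j ∈ I :=
            Finset.mem_filter.2 ⟨Finset.mem_univ j, hj⟩
          exact ⟨hmin j this, hmax j this⟩
      _ ≤ P.real (Icc (x i j₁) (x i j₂)) + κ := hi _ _ (hmin j₂ hj₂)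
      _ ≤ P.real I + κ := by
          have := measureReal_mono (μ := P) hsub
          linarith

/-- Layer-cake formula: both integrals are integrals over `t ∈ (0, B]` of the masses of superlevel
sets, and these sets are intervals. The error does not depend on `v`, so random `v` are allowed. -/
theorem integral_empirical_le {n : ℕ} (x : Fin n → ℝ) (hn : n ≠ 0) (P : Measure ℝ)
    [IsProbabilityMeasure P] {κ B : ℝ}
    (h : ∀ I : Set ℝ, OrdConnected I → (empirical x).real I ≤ P.real I + κ) {v : ℝ → ℝ}
    (hv0 : ∀ y, 0 ≤ v y) (hvB : ∀ y, v y ≤ B) (hv : ∀ t, OrdConnected {y | t ≤ v y}) :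
    ∫ y, v y ∂(empirical x) ≤ ∫ y, v y ∂P + B * κ := by
  have := isProbabilityMeasure_empirical x hn
  have hB : 0 ≤ B := (hv0 0).trans (hvB 0)
  have hmv : Measurable v := measurable_of_Ici fun t => (hv t).measurableSet
  have hint : ∀ (ν : Measure ℝ) [IsProbabilityMeasure ν], Integrable v ν := fun ν _ =>
    Integrable.of_bound hmv.aestronglyMeasurable B
      (ae_of_all _ fun y => by rw [Real.norm_eq_abs, abs_of_nonneg (hv0 y)]; exact hvB y)
  have hlc : ∀ (ν : Measure ℝ) [IsProbabilityMeasure ν],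
      IntegrableOn (fun t => ν.real {y | t ≤ v y}) (Ioc 0 B) := fun ν _ => by
    have hanti : Antitone fun t => ν.real {y | t ≤ v y} := fun s t hst =>
      measureReal_mono fun y hy => hst.trans hy
    exact (hanti.antitoneOn _).integrableOn_isCompact isCompact_Icc |>.mono_set Ioc_subset_Icc_self
  have e : ∀ (ν : Measure ℝ) [IsProbabilityMeasure ν],
      ∫ y, v y ∂ν = ∫ t in Ioc 0 B, ν.real {y | t ≤ v y} := fun ν _ =>
    (hint ν).integral_eq_integral_Ioc_meas_le (ae_of_all _ hv0) (ae_of_all _ hvB)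
  rw [e (empirical x), e P]
  have : ∫ t in Ioc 0 B, (P.real {y | t ≤ v y} + κ)
      = (∫ t in Ioc 0 B, P.real {y | t ≤ v y}) + B * κ := by
    rw [integral_add (hlc P) (by simp), setIntegral_const]
    simp [hB]
  rw [← this]
  exact setIntegral_mono (hlc _) ((hlc P).add (by simp)) fun t => h _ (hv t)

theorem law_nullSingletonClass (φ : ℝ → EReal) : NullSingletonClass (law φ) :=
  ⟨fun y => law_absolutelyContinuous φ (by simp)⟩

/-- Absolute continuity of the integral, uniform in the centre because all balls of one radius have
the same length. -/
theorem exists_closedBall_law_le {φ : ℝ → EReal} (hφ : IsLogConcaveLogDensity φ) {ε : ℝ}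
    (hε : 0 < ε) : ∃ ρ : ℝ, 0 < ρ ∧ ∀ y, (law φ).real (Metric.closedBall y ρ) ≤ ε := by
  obtain ⟨δ, hδ, h⟩ := exists_pos_setLIntegral_lt_of_measure_lt
    (f := fun x => EReal.exp (φ x)) (μ := volume) (by simp [hφ.lintegral_exp])
    (ε := ENNReal.ofReal ε) (by simpa using hε)
  obtain ⟨η, hη0, hηδ⟩ := ENNReal.lt_iff_exists_nnreal_btwn.1 hδ
  have hη : (0 : ℝ) < η := by exact_mod_cast hη0
  refine ⟨η / 4, by linarith, fun y => ?_⟩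
  refine ENNReal.toReal_le_of_le_ofReal hε.le ?_
  rw [law, withDensity_apply _ measurableSet_closedBall]
  refine (h _ ?_).le
  rw [Real.volume_closedBall]
  refine lt_of_le_of_lt ?_ hηδ
  rw [← ENNReal.ofReal_coe_nnreal]
  exact ENNReal.ofReal_le_ofReal (by linarith)

/-! ### An upper bound for the estimator at the data -/

theorem coe_sum_ereal {α : Type*} (s : Finset α) (a : α → ℝ) :
    ((∑ j ∈ s, a j : ℝ) : EReal) = ∑ j ∈ s, (a j : EReal) := by
  classical
  induction s using Finset.induction_on with
  | empty => simp
  | insert j s hj ih => rw [Finset.sum_insert hj, Finset.sum_insert hj, EReal.coe_add, ih]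

theorem sum_eq_coe {α : Type*} {s : Finset α} {a : α → EReal} {c : ℝ}
    (ha : ∀ j ∈ s, a j < ⊤) (h : (c : EReal) ≤ ∑ j ∈ s, a j) :
    (∀ j ∈ s, ⊥ < a j) ∧ c ≤ ∑ j ∈ s, (a j).toReal := by
  classical
  have h1 : ∀ j ∈ s, ⊥ < a j := by
    intro j hj
    by_contra h'
    rw [not_bot_lt_iff] at h'
    rw [← Finset.add_sum_erase s a hj, h', EReal.bot_add, le_bot_iff] at h
    exact EReal.coe_ne_bot c h
  refine ⟨h1, ?_⟩
  rw [← EReal.coe_le_coe_iff, coe_sum_ereal]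
  convert h using 2 with j hj
  exact EReal.coe_toReal (ha j hj).ne (h1 j hj).ne'

/-- The true `φ` is a competitor with finite likelihood; a single value `⊥` at a data point would
make the likelihood of `g` equal to `⊥`. -/
theorem IsLogConcaveMLE.data_mem_dom_and_sum_le {n : ℕ} {x : Fin n → ℝ} {g φ : ℝ → EReal}
    (hg : IsLogConcaveMLE x g) (hφ : IsLogConcaveLogDensity φ) (hx : ∀ j, x j ∈ dom φ) :
    (∀ j, x j ∈ dom g) ∧ ∑ j, (φ (x j)).toReal ≤ ∑ j, (g (x j)).toReal := by
  have h := hg.2 φ hφ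
  have h1 : ∑ j, φ (x j) = ((∑ j, (φ (x j)).toReal : ℝ) : EReal) := by
    rw [coe_sum_ereal]
    exact Finset.sum_congr rfl fun j _ => (coe_toReal_of_mem_dom hφ (hx j)).symm
  rw [h1] at h
  have := sum_eq_coe (fun j _ => hg.1.lt_top (x j)) h
  exact ⟨fun j => this.1 j (Finset.mem_univ j), this.2⟩

/-- A high peak must be narrow. Going the fraction `1 / (m + A)` of the way from `c` to `y` costs at
most `1` in log-density, so that segment carries density at least `exp (m - 1)`, while its mass is
at most `1`. -/
theorem IsLogConcaveLogDensity.abs_sub_le {g : ℝ → EReal} (hg : IsLogConcaveLogDensity g)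
    {c y m A : ℝ} (hc : (m : EReal) ≤ g c) (hy : ((-A : ℝ) : EReal) ≤ g y) (hk : 1 < m + A) :
    |y - c| ≤ (m + A) * Real.exp (1 - m) := by
  set k := m + A with hkdef
  have hk0 : 0 < k := by linarith
  set z := c + (y - c) / k with hz
  have hzg : ((m - 1 : ℝ) : EReal) ≤ g z := by
    have h1 : 0 < 1 / k := by positivity
    have h2 : 0 < 1 - 1 / k := by
      have : 1 / k < 1 := by rw [div_lt_one hk0]; exact hk
      linarith
    have := hg.concave.combo_le h2 h1 (by ring) hc hy
    convert this using 2
    · field_simp; rw [hkdef]; ring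
    · rw [hz]; field_simp; ring
  have hcg : ((m - 1 : ℝ) : EReal) ≤ g c :=
    le_trans (EReal.coe_le_coe_iff.2 (by linarith)) hc
  have hsub : uIcc c z ⊆ {x | ((m - 1 : ℝ) : EReal) ≤ g x} :=
    (hg.concave.ordConnected_le (m - 1)).uIcc_subset hcg hzg
  have h1 : EReal.exp ((m - 1 : ℝ) : EReal) * volume (uIcc c z) ≤ 1 := by
    rw [← setLIntegral_const, ← hg.lintegral_exp]
    refine (setLIntegral_mono' measurableSet_uIcc fun x hx => ?_).trans
      (setLIntegral_le_lintegral _ _)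
    exact EReal.exp_monotone (hsub hx)
  rw [Real.volume_interval, EReal.exp_coe, ← ENNReal.ofReal_mul (Real.exp_pos _).le,
    ENNReal.ofReal_le_one] at h1
  have h2 : |z - c| = |y - c| / k := by
    rw [hz, add_sub_cancel_left, abs_div, abs_of_pos hk0]
  rw [h2] at h1
  have h3 : Real.exp (m - 1) * Real.exp (1 - m) = 1 := by rw [← Real.exp_add]; simp
  have h4 := mul_le_mul_of_nonneg_right h1 (Real.exp_pos (1 - m)).le
  have h5 : Real.exp (m - 1) * (|y - c| / k) * Real.exp (1 - m) = |y - c| / k := by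
    calc _ = (Real.exp (m - 1) * Real.exp (1 - m)) * (|y - c| / k) := by ring
      _ = _ := by rw [h3, one_mul]
  rw [h5, one_mul, div_le_iff₀ hk0] at h4
  linarith

/-- If the maximum `m` over the data exceeded `M`, the set where `g ≥ -4 * m` would lie in a ball of
radius `5 * m * exp (1 - m) ≤ ρ` and hold at most half of the data. The mean log-likelihood would
then be at most `-4 * m + 5 * m / 2 = -(3 / 2) * m`, below that of `φ`. -/
theorem IsLogConcaveMLE.data_le {n : ℕ} {x : Fin n → ℝ} {g φ : ℝ → EReal}
    (hg : IsLogConcaveMLE x g) (hφ : IsLogConcaveLogDensity φ) (hn : n ≠ 0)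
    (hx : ∀ j, x j ∈ dom φ)
    (hP : ∀ I : Set ℝ, OrdConnected I → (empirical x).real I ≤ (law φ).real I + 1 / 4)
    {ρ L M : ℝ} (hρ : ∀ y, (law φ).real (Metric.closedBall y ρ) ≤ 1 / 4)
    (hL : L ≤ ∫ y, (φ y).toReal ∂(empirical x)) (hM : 1 ≤ M) (hML : -(3 / 2) * M ≤ L)
    (hMρ : ∀ m, M ≤ m → 5 * m * Real.exp (1 - m) ≤ ρ) (j : Fin n) : g (x j) ≤ M := by
  have := hφ.isProbabilityMeasure
  have := isProbabilityMeasure_empirical x hn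
  obtain ⟨hdom, hsum⟩ := hg.data_mem_dom_and_sum_le hφ hx
  obtain ⟨j₀, -, hj₀⟩ := Finset.exists_max_image Finset.univ (fun j => g (x j)) ⟨j, Finset.mem_univ j⟩
  refine (hj₀ j (Finset.mem_univ j)).trans ?_
  by_contra! hlt
  set m := (g (x j₀)).toReal with hm
  have hgm : (m : EReal) = g (x j₀) := coe_toReal_of_mem_dom hg.1 (hdom j₀)
  have hMm : M < m := by rw [← EReal.coe_lt_coe_iff, hgm]; exact hlt
  set G : Set ℝ := {y | ((-(4 * m) : ℝ) : EReal) ≤ g y} with hG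
  have hGo : OrdConnected G := hg.1.concave.ordConnected_le _
  have hGsub : G ⊆ Metric.closedBall (x j₀) ρ := by
    intro y hy
    rw [Metric.mem_closedBall, Real.dist_eq]
    have := hg.1.abs_sub_le hgm.le hy (by linarith)
    have e : m + 4 * m = 5 * m := by ring
    rw [e] at this
    exact this.trans (hMρ m hMm.le)
  have hGle : (empirical x).real G ≤ 1 / 2 := by
    have h1 := hP G hGo
    have h2 : (law φ).real G ≤ (law φ).real (Metric.closedBall (x j₀) ρ) := measureReal_mono hGsub
    linarith [hρ (x j₀)]
  have hpt : ∀ j, (g (x j)).toReal ≤ -(4 * m) + 5 * m * G.indicator 1 (x j) := by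
    intro j
    have hgj : ((g (x j)).toReal : EReal) = g (x j) := coe_toReal_of_mem_dom hg.1 (hdom j)
    by_cases hj : x j ∈ G
    · rw [indicator_of_mem hj, Pi.one_apply, ← EReal.coe_le_coe_iff, hgj]
      refine (hj₀ j (Finset.mem_univ j)).trans ?_
      rw [← hgm, EReal.coe_le_coe_iff]
      linarith
    · rw [indicator_of_notMem hj, ← EReal.coe_le_coe_iff, hgj]
      have : g (x j) < ((-(4 * m) : ℝ) : EReal) := not_le.1 hj
      simpa using this.le
  have hn' : (0 : ℝ) < n := by exact_mod_cast Nat.pos_of_ne_zero hn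
  have h1 : (∑ j, (g (x j)).toReal) / n
      ≤ ∫ y, (-(4 * m) + 5 * m * G.indicator (1 : ℝ → ℝ) y) ∂(empirical x) := by
    rw [integral_empirical]
    gcongr with j
    exact hpt j
  have h2 : ∫ y, (-(4 * m) + 5 * m * G.indicator (1 : ℝ → ℝ) y) ∂(empirical x)
      = -(4 * m) + 5 * m * (empirical x).real G := by
    have hind : Integrable (G.indicator (1 : ℝ → ℝ)) (empirical x) :=
      (integrable_const (1 : ℝ)).indicator hGo.measurableSet
    rw [integral_add (integrable_const _) (hind.const_mul _),
      integral_const_mul, integral_indicator_one hGo.measurableSet]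
    simp
  rw [integral_empirical] at hL
  have h3 : (∑ j, (φ (x j)).toReal) / n ≤ (∑ j, (g (x j)).toReal) / n := by gcongr
  nlinarith

/-! ### Truncation and the likelihood gap -/

/-- The function `g`, truncated below at `-R` and above at `M`. -/
noncomputable def clamp (g : ℝ → EReal) (R M : ℝ) (y : ℝ) : ℝ :=
  (max (min (g y) (M : EReal)) ((-R : ℝ) : EReal)).toReal

theorem coe_clamp (g : ℝ → EReal) (R M : ℝ) (y : ℝ) :
    (clamp g R M y : EReal) = max (min (g y) (M : EReal)) ((-R : ℝ) : EReal) := by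
  refine EReal.coe_toReal (ne_of_lt ?_) (ne_of_gt ?_)
  · exact max_lt (lt_of_le_of_lt (min_le_right _ _) (EReal.coe_lt_top M)) (EReal.coe_lt_top _)
  · exact lt_of_lt_of_le (EReal.bot_lt_coe _) (le_max_right _ _)

theorem neg_le_clamp (g : ℝ → EReal) (R M : ℝ) (y : ℝ) : -R ≤ clamp g R M y := by
  rw [← EReal.coe_le_coe_iff, coe_clamp]
  exact le_max_right _ _

theorem clamp_le {g : ℝ → EReal} {R M : ℝ} (h : -R ≤ M) (y : ℝ) : clamp g R M y ≤ M := by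
  rw [← EReal.coe_le_coe_iff, coe_clamp]
  exact max_le (min_le_right _ _) (EReal.coe_le_coe_iff.2 h)

theorem le_clamp {g : ℝ → EReal} {R M a : ℝ} {y : ℝ} (h : (a : EReal) ≤ g y) (ha : a ≤ M) :
    a ≤ clamp g R M y := by
  rw [← EReal.coe_le_coe_iff, coe_clamp]
  exact (le_min h (EReal.coe_le_coe_iff.2 ha)).trans (le_max_left _ _)

theorem clamp_le_of_le {g : ℝ → EReal} {R M a : ℝ} {y : ℝ} (h : g y ≤ a) (ha : -R ≤ a) :
    clamp g R M y ≤ a := by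
  rw [← EReal.coe_le_coe_iff, coe_clamp]
  exact max_le ((min_le_left _ _).trans h) (EReal.coe_le_coe_iff.2 ha)

theorem ordConnected_le_clamp {g : ℝ → EReal} (hg : IsConcave g) (R M t : ℝ) :
    OrdConnected {y | t ≤ clamp g R M y} := by
  have e : ∀ y, t ≤ clamp g R M y ↔ ((t : EReal) ≤ g y ∧ t ≤ M) ∨ t ≤ -R := by
    intro y
    rw [← EReal.coe_le_coe_iff, coe_clamp, le_max_iff, le_min_iff, EReal.coe_le_coe_iff,
      EReal.coe_le_coe_iff]
  simp only [e]
  by_cases h1 : t ≤ -R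
  · simpa [h1] using ordConnected_univ
  by_cases h2 : t ≤ M
  · simpa [h1, h2] using hg.ordConnected_le t
  · simpa [h1, h2] using ordConnected_empty

theorem measurable_clamp {g : ℝ → EReal} (hg : IsConcave g) (R M : ℝ) :
    Measurable (clamp g R M) :=
  measurable_of_Ici fun t => (ordConnected_le_clamp hg R M t).measurableSet

theorem IsLogConcaveLogDensity.exp_clamp_le {g : ℝ → EReal} (hg : IsLogConcaveLogDensity g)
    (R M y : ℝ) : Real.exp (clamp g R M y) ≤ dens g y + Real.exp (-R) := by
  have h0 := dens_nonneg g y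
  have hp := Real.exp_pos (-R)
  rcases le_or_gt (clamp g R M y) (-R) with h | h
  · have := Real.exp_le_exp.2 h
    linarith
  · by_cases hy : y ∈ dom g
    · rw [hg.dens_of_mem hy]
      have : clamp g R M y ≤ (g y).toReal := by
        rw [← EReal.coe_lt_coe_iff, coe_clamp, lt_max_iff] at h
        rw [← EReal.coe_le_coe_iff, coe_clamp, coe_toReal_of_mem_dom hg hy]
        refine max_le (min_le_left _ _) ?_
        exact (h.resolve_right (lt_irrefl _)).le.trans (min_le_left _ _)
      have := Real.exp_le_exp.2 this
      linarith
    · exfalso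
      have : clamp g R M y ≤ -R := clamp_le_of_le (by rw [notMem_dom_iff.1 hy]; exact bot_le) le_rfl
      linarith

/-- For `z ≥ -2` square `1 + z / 2 ≤ exp (z / 2)`; for `z < -2` the right side exceeds `1`, which is
where `ε ≤ 1` is used. -/
theorem sq_div_four_le_exp_sub {z ε : ℝ} (hε0 : 0 ≤ ε) (hε : ε ≤ 1) (hz : ε ≤ |z|) :
    ε ^ 2 / 4 ≤ Real.exp z - 1 - z := by
  rcases le_or_gt (-2) z with h | h
  · have h1 : 1 + z / 2 ≤ Real.exp (z / 2) := by linarith [Real.add_one_le_exp (z / 2)]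
    have h2 : Real.exp z = Real.exp (z / 2) ^ 2 := by rw [← Real.exp_nat_mul]; congr 1; push_cast; ring
    have h3 : (1 + z / 2) ^ 2 ≤ Real.exp (z / 2) ^ 2 := pow_le_pow_left₀ (by linarith) h1 2
    have h4 : ε ^ 2 ≤ z ^ 2 := by rw [← sq_abs z]; exact pow_le_pow_left₀ hε0 hz 2
    nlinarith
  · have := Real.exp_pos z
    nlinarith

theorem IsLogConcaveLogDensity.law_real {φ : ℝ → EReal} (hφ : IsLogConcaveLogDensity φ)
    {s : Set ℝ} (hs : MeasurableSet s) : (law φ).real s = ∫ x in s, dens φ x := by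
  have := hφ.setIntegral_law (fun _ => 1) hs
  simpa using this

/-- With `z = u - φ y` the expression is `f * (exp z - 1 - z)`. Off `dom φ` the default `toReal ⊥ =
0` is harmless, as it is multiplied by the density `0`. -/
theorem exp_sub_dens_nonneg {φ : ℝ → EReal} (hφ : IsLogConcaveLogDensity φ) (u y : ℝ) :
    0 ≤ Real.exp u - dens φ y - dens φ y * (u - (φ y).toReal) := by
  by_cases hy : y ∈ dom φ
  · rw [hφ.dens_of_mem hy]
    have h1 : Real.exp u = Real.exp (φ y).toReal * Real.exp (u - (φ y).toReal) := by
      rw [← Real.exp_add]; ring_nf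
    have h2 := Real.add_one_le_exp (u - (φ y).toReal)
    have h3 := Real.exp_pos (φ y).toReal
    rw [h1]
    nlinarith
  · rw [dens_of_notMem hy]
    simp [Real.exp_nonneg]

theorem exp_sub_dens_ge {φ : ℝ → EReal} (hφ : IsLogConcaveLogDensity φ) {u y ε : ℝ}
    (hy : y ∈ dom φ) (hε0 : 0 ≤ ε) (hε : ε ≤ 1) (hu : ε ≤ |u - (φ y).toReal|) :
    ε ^ 2 / 4 * dens φ y ≤ Real.exp u - dens φ y - dens φ y * (u - (φ y).toReal) := by
  rw [hφ.dens_of_mem hy]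
  have h1 : Real.exp u = Real.exp (φ y).toReal * Real.exp (u - (φ y).toReal) := by
    rw [← Real.exp_add]; ring_nf
  have h2 := sq_div_four_le_exp_sub hε0 hε hu
  have h3 := Real.exp_pos (φ y).toReal
  rw [h1]
  nlinarith

/-- The divergence density `exp u - f - f * (u - φ)` is nonnegative and at least `ε ^ 2 / 4 * f` on
`J`. Its integral over `[-T, T]` is small because `exp u` has mass little more than `1` there, while
maximality keeps the mean of `u` from falling much below that of `φ`. The three summands on the
right account for the floor `-R`, the tails, and the sampling error. -/
theorem IsLogConcaveMLE.gap_le {n : ℕ} {x : Fin n → ℝ} {g φ : ℝ → EReal}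
    (hg : IsLogConcaveMLE x g) (hφ : IsLogConcaveLogDensity φ) (husc : UpperSemicontinuous φ)
    (hn : n ≠ 0) (hx : ∀ j, x j ∈ dom φ) {κ M R T ε : ℝ}
    (hP : ∀ I : Set ℝ, OrdConnected I → (empirical x).real I ≤ (law φ).real I + κ)
    (hM : ∀ j, g (x j) ≤ M) (hRM : -R ≤ M) (hT : 0 ≤ T) {J : Set ℝ} (hJ : MeasurableSet J)
    (hJT : J ⊆ Icc (-T) T) (hJφ : J ⊆ dom φ) (hε0 : 0 ≤ ε) (hε : ε ≤ 1)
    (hgap : ∀ y ∈ J, ε ≤ |clamp g R M y - (φ y).toReal|) :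
    ε ^ 2 / 4 * (law φ).real J ≤ 2 * T * Real.exp (-R)
      + ∫ y in (Icc (-T) T)ᶜ, (1 + M - (φ y).toReal) ∂(law φ)
      + ((M + R) * κ + (∫ y, (φ y).toReal ∂(law φ) - ∫ y, (φ y).toReal ∂(empirical x))) := by
  have := hφ.isProbabilityMeasure
  have := isProbabilityMeasure_empirical x hn
  obtain ⟨hdom, hsum⟩ := hg.data_mem_dom_and_sum_le hφ hx
  set u := clamp g R M with hu
  set K := Icc (-T) T with hK
  have hKm : MeasurableSet K := measurableSet_Icc
  have hum : Measurable u := measurable_clamp hg.1.concave R M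
  have hubd : ∀ y, ‖u y‖ ≤ max |M| |R| := by
    intro y
    have h1 := clamp_le (g := g) hRM y
    have h2 := neg_le_clamp g R M y
    rw [Real.norm_eq_abs, abs_le]
    constructor
    · linarith [le_abs_self R, le_max_right |M| |R|]
    · linarith [le_abs_self M, le_max_left |M| |R|]
  have hui : ∀ (ν : Measure ℝ) [IsFiniteMeasure ν], Integrable u ν := fun ν _ =>
    Integrable.of_bound hum.aestronglyMeasurable _ (ae_of_all _ hubd)
  have hpi := hφ.integrable_toReal husc
  have I1 : ∫ y, (φ y).toReal ∂(empirical x) ≤ ∫ y, u y ∂(empirical x) := by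
    rw [integral_empirical, integral_empirical]
    have : ∑ j, (g (x j)).toReal ≤ ∑ j, u (x j) := by
      refine Finset.sum_le_sum fun j _ => ?_
      have e := coe_toReal_of_mem_dom hg.1 (hdom j)
      refine le_clamp e.le ?_
      rw [← EReal.coe_le_coe_iff, e]
      exact hM j
    have h := hsum.trans this
    gcongr
  have I2 : ∫ y, u y ∂(empirical x) ≤ ∫ y, u y ∂(law φ) + (M + R) * κ := by
    -- Shifting by `R` makes the truncated function nonnegative with upper bound `M + R`.
    have h := integral_empirical_le x hn (law φ) hP (v := fun y => u y + R) (B := M + R)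
      (fun y => by have := neg_le_clamp g R M y; linarith)
      (fun y => by have := clamp_le (g := g) hRM y; linarith)
      (fun t => by
        have := ordConnected_le_clamp hg.1.concave R M (t - R)
        simpa only [sub_le_iff_le_add] using this)
    rw [integral_add (hui _) (integrable_const _), integral_add (hui _) (integrable_const _)] at h
    simp only [integral_const, probReal_univ, one_smul] at h
    linarith
  have I3 : ∫ y, u y ∂(law φ) ≤ ∫ y in K, u y ∂(law φ) + M * (law φ).real Kᶜ := by
    rw [← integral_add_compl hKm (hui (law φ))]
    have : ∫ y in Kᶜ, u y ∂(law φ) ≤ ∫ y in Kᶜ, M ∂(law φ) :=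
      setIntegral_mono (hui (law φ)).integrableOn (integrable_const _).integrableOn
        fun y => clamp_le hRM y
    rw [setIntegral_const, smul_eq_mul, mul_comm] at this
    linarith
  have I4 := integral_add_compl hKm hpi
  -- In the tail term, `M` bounds `u` off `K`, and the `1` compensates for the mass that `law φ` has
  -- off `K`.
  have I4' : ∫ y in Kᶜ, (1 + M - (φ y).toReal) ∂(law φ)
      = (1 + M) * (law φ).real Kᶜ - ∫ y in Kᶜ, (φ y).toReal ∂(law φ) := by
    rw [integral_sub (integrable_const _).integrableOn hpi.integrableOn, setIntegral_const,
      smul_eq_mul, mul_comm]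
  have hexpm : Measurable fun y => Real.exp (u y) := Real.measurable_exp.comp hum
  have hKfin : volume K ≠ ⊤ := by rw [hK, Real.volume_Icc]; exact ENNReal.ofReal_ne_top
  have hexpi : IntegrableOn (fun y => Real.exp (u y)) K := by
    refine Measure.integrableOn_of_bounded (M := Real.exp M) hKfin hexpm.aestronglyMeasurable
      (ae_of_all _ fun y => ?_)
    rw [Real.norm_eq_abs, abs_of_pos (Real.exp_pos _)]
    exact Real.exp_le_exp.2 (clamp_le hRM y)
  have hfi := hφ.integrable_dens
  have hupi : Integrable (fun y => u y - (φ y).toReal) (law φ) := (hui _).sub hpi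
  have hupi' : Integrable (fun y => dens φ y * (u y - (φ y).toReal)) :=
    (hφ.integrable_law_iff _).1 hupi
  have hexpfi : IntegrableOn (fun y => Real.exp (u y) - dens φ y) K := hexpi.sub hfi.integrableOn
  have I5 : ε ^ 2 / 4 * (law φ).real J ≤ (∫ y in K, Real.exp (u y)) - (law φ).real K
      - (∫ y in K, u y ∂(law φ) - ∫ y in K, (φ y).toReal ∂(law φ)) := by
    rw [← integral_sub (hui _).integrableOn hpi.integrableOn, hφ.setIntegral_law _ hKm,
      hφ.law_real hKm, hφ.law_real hJ, ← integral_sub hexpi hfi.integrableOn,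
      ← integral_sub hexpfi hupi'.integrableOn, ← integral_const_mul]
    have hint : IntegrableOn (fun y => Real.exp (u y) - dens φ y
        - dens φ y * (u y - (φ y).toReal)) K :=
      hexpfi.sub hupi'.integrableOn
    calc ∫ y in J, ε ^ 2 / 4 * dens φ y
        ≤ ∫ y in J, (Real.exp (u y) - dens φ y - dens φ y * (u y - (φ y).toReal)) :=
          setIntegral_mono_on (hfi.const_mul _).integrableOn (hint.mono_set hJT) hJ
            fun y hy => exp_sub_dens_ge hφ (hJφ hy) hε0 hε (hgap y hy)
      _ ≤ _ := setIntegral_mono_set hint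
          (ae_of_all _ fun y => exp_sub_dens_nonneg hφ (u y) y) (ae_of_all _ hJT)
  have I6 : ∫ y in K, Real.exp (u y) ≤ 1 + 2 * T * Real.exp (-R) := by
    have hgi := hg.1.integrable_dens
    have hc : IntegrableOn (fun _ : ℝ => Real.exp (-R)) K := integrableOn_const hKfin
    calc ∫ y in K, Real.exp (u y) ≤ ∫ y in K, (dens g y + Real.exp (-R)) :=
          setIntegral_mono hexpi (hgi.integrableOn.add hc) fun y => hg.1.exp_clamp_le R M y
      _ = (∫ y in K, dens g y) + 2 * T * Real.exp (-R) := by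
          rw [integral_add hgi.integrableOn hc, setIntegral_const, hK, Real.volume_real_Icc_of_le
            (by linarith), smul_eq_mul]
          ring
      _ ≤ 1 + 2 * T * Real.exp (-R) := by
          have := setIntegral_le_integral (s := K) hgi (ae_of_all _ (dens_nonneg g))
          rw [hg.1.integral_dens] at this
          linarith
  have I7 : (law φ).real K = 1 - (law φ).real Kᶜ := by
    rw [probReal_compl_eq_one_sub hKm]; ring
  rw [I4']
  linarith

/-! ### Pointwise convergence in the interior of the support -/

/-- Along the filter `l`, the empirical distributions of the data `x i` approach the distribution
with log-density `φ`, and `g i` is the log-concave maximum likelihood estimator based on `x i`. -/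
structure EmpiricalConvergence {ι : Type*} (l : Filter ι) (φ : ℝ → EReal) {N : ι → ℕ}
    (x : ∀ i, Fin (N i) → ℝ) (g : ι → ℝ → EReal) : Prop where
  ne_zero : ∀ᶠ i in l, N i ≠ 0
  tendsto_cdf : ∀ q, Tendsto (fun i => (empirical (x i)).real (Iic q)) l
    (𝓝 ((law φ).real (Iic q)))
  tendsto_integral : Tendsto (fun i => ∫ y, (φ y).toReal ∂(empirical (x i))) l
    (𝓝 (∫ y, (φ y).toReal ∂(law φ)))
  mle : ∀ᶠ i in l, IsLogConcaveMLE (x i) (g i)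
  data_mem : ∀ᶠ i in l, ∀ j, x i j ∈ interior (dom φ)

section

variable {ι : Type*} {l : Filter ι} {φ : ℝ → EReal} {N : ι → ℕ} {x : ∀ i, Fin (N i) → ℝ}
  {g : ι → ℝ → EReal}

theorem EmpiricalConvergence.eventually_ordConnected_le (h : EmpiricalConvergence l φ x g)
    (hφ : IsLogConcaveLogDensity φ) {κ : ℝ} (hκ : 0 < κ) :
    ∀ᶠ i in l, ∀ I : Set ℝ, OrdConnected I → (empirical (x i)).real I ≤ (law φ).real I + κ :=
  have := hφ.isProbabilityMeasure
  have := law_nullSingletonClass φ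
  eventually_empirical_ordConnected_le (law φ) h.ne_zero h.tendsto_cdf hκ

theorem EmpiricalConvergence.exists_bound (h : EmpiricalConvergence l φ x g)
    (hφ : IsLogConcaveLogDensity φ) (M₀ : ℝ) : ∃ M, M₀ ≤ M ∧ ∀ᶠ i in l, ∀ j, g i (x i j) ≤ (M : ℝ) := by
  obtain ⟨ρ, hρ0, hρ⟩ := exists_closedBall_law_le hφ (ε := 1 / 4) (by norm_num)
  set L := ∫ y, (φ y).toReal ∂(law φ) - 1 with hL
  have hlim : Tendsto (fun m : ℝ => 5 * m * Real.exp (1 - m)) atTop (𝓝 0) := by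
    have := (Real.tendsto_pow_mul_exp_neg_atTop_nhds_zero 1).const_mul (5 * Real.exp 1)
    rw [mul_zero] at this
    refine this.congr fun m => ?_
    rw [sub_eq_add_neg, Real.exp_add, pow_one]
    ring
  obtain ⟨M₁, hM₁⟩ := eventually_atTop.1 (hlim.eventually_le_const hρ0)
  refine ⟨max (max M₀ M₁) (max 1 (-L)), (le_max_left _ _).trans (le_max_left _ _), ?_⟩
  filter_upwards [h.eventually_ordConnected_le hφ (κ := 1 / 4) (by norm_num), h.ne_zero, h.mle,
    h.data_mem, h.tendsto_integral.eventually_const_le (show L < _ by rw [hL]; linarith)]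
    with i h1 h2 h3 h4 h5 j
  set M := max (max M₀ M₁) (max 1 (-L))
  have b1 : 1 ≤ M := (le_max_left _ _).trans (le_max_right _ _)
  have b2 : -L ≤ M := (le_max_right _ _).trans (le_max_right _ _)
  have b3 : M₁ ≤ M := (le_max_right _ _).trans (le_max_left _ _)
  exact h3.data_le hφ h2 (fun j => interior_subset (h4 j)) h1 hρ h5 b1 (by linarith)
    (fun m hm => hM₁ m (b3.trans hm)) j

theorem tendsto_setIntegral_compl_Icc {ν : Measure ℝ} {h : ℝ → ℝ} (hi : Integrable h ν) :
    Tendsto (fun T : ℝ => ∫ y in (Icc (-T) T)ᶜ, h y ∂ν) atTop (𝓝 0) := by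
  have hc : AECover ν atTop fun T : ℝ => Icc (-T) T :=
    aecover_Icc tendsto_neg_atTop_atBot tendsto_id
  have h1 := (hc.integral_tendsto_of_countably_generated hi).const_sub (∫ y, h y ∂ν)
  rw [sub_self] at h1
  refine h1.congr fun T => ?_
  rw [← integral_add_compl (measurableSet_Icc (a := -T) (b := T)) hi]
  ring

/-- If the estimator stayed `ε` away from `φ` on all of `(a, b)`, the gap inequality would have left
side `δ > 0`. Each of the four errors on its right can be pushed to at most `δ / 8`, choosing `T`,
then `R`, then `κ`. -/
theorem EmpiricalConvergence.exists_near (h : EmpiricalConvergence l φ x g)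
    (hφ : IsLogConcaveLogDensity φ) (husc : UpperSemicontinuous φ) {a b ε : ℝ} (hab : a < b)
    (ha : a ∈ dom φ) (hb : b ∈ dom φ) (hε : 0 < ε) :
    ∀ᶠ i in l, ∃ y ∈ Ioo a b, (((φ y).toReal - ε : ℝ) : EReal) ≤ g i y ∧
      g i y ≤ (((φ y).toReal + ε : ℝ) : EReal) := by
  wlog hε1 : ε ≤ 1 generalizing ε
  · filter_upwards [this one_pos le_rfl] with i ⟨y, hy, h1, h2⟩
    push Not at hε1
    exact ⟨y, hy, le_trans (EReal.coe_le_coe_iff.2 (by linarith)) h1,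
      h2.trans (EReal.coe_le_coe_iff.2 (by linarith))⟩
  have := hφ.isProbabilityMeasure
  obtain ⟨α, β, hβ, hαβ⟩ := hφ.exists_exp_bound husc
  obtain ⟨M, hM₀, hM⟩ := h.exists_bound hφ (max 0 (α + 1))
  have hM0 : 0 ≤ M := (le_max_left _ _).trans hM₀
  have hMα : α + 1 ≤ M := (le_max_right _ _).trans hM₀
  have hJφ : Ioo a b ⊆ dom φ := Ioo_subset_Icc_self.trans (hφ.concave.ordConnected_dom.out ha hb)
  obtain ⟨m, hm⟩ : ∃ m : ℝ, ∀ y ∈ Ioo a b, m ≤ (φ y).toReal := by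
    refine ⟨min (φ a).toReal (φ b).toReal, fun y hy => ?_⟩
    rw [← EReal.coe_le_coe_iff, coe_toReal_of_mem_dom hφ (hJφ hy)]
    refine (hφ.concave.ordConnected_le _).out ?_ ?_ (Ioo_subset_Icc_self hy)
    · rw [mem_ofPred_eq, ← coe_toReal_of_mem_dom hφ ha, EReal.coe_le_coe_iff]
      exact min_le_left _ _
    · rw [mem_ofPred_eq, ← coe_toReal_of_mem_dom hφ hb, EReal.coe_le_coe_iff]
      exact min_le_right _ _
  have hub : ∀ y ∈ Ioo a b, (φ y).toReal ≤ α := by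
    intro y hy
    rw [← EReal.coe_le_coe_iff, coe_toReal_of_mem_dom hφ (hJφ hy)]
    refine (hαβ y).trans (EReal.coe_le_coe_iff.2 ?_)
    linarith [mul_nonneg hβ.le (abs_nonneg y)]
  set δ := ε ^ 2 / 4 * (law φ).real (Ioo a b) with hδ
  have hδ0 : 0 < δ := by
    refine mul_pos (by positivity) ?_
    exact ENNReal.toReal_pos (law_pos_of_Ioo_subset hφ hab subset_rfl hJφ).ne' (measure_ne_top _ _)
  obtain ⟨T, hT1, hT2⟩ := ((tendsto_setIntegral_compl_Icc (ν := law φ)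
    ((integrable_const (1 + M)).sub (hφ.integrable_toReal husc))).eventually_lt_const
    (show 0 < δ / 8 by linarith) |>.and (eventually_ge_atTop (max |a| |b|))).exists
  have hT0 : 0 ≤ T := (abs_nonneg a).trans ((le_max_left _ _).trans hT2)
  have hJT : Ioo a b ⊆ Icc (-T) T := by
    intro y hy
    have h1 := (le_max_left _ _).trans hT2
    have h2 := (le_max_right _ _).trans hT2
    constructor
    · linarith [neg_abs_le a, hy.1]
    · linarith [le_abs_self b, hy.2]
  have hRlim : Tendsto (fun R : ℝ => 2 * T * Real.exp (-R)) atTop (𝓝 0) := by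
    have := (Real.tendsto_exp_neg_atTop_nhds_zero).const_mul (2 * T)
    rwa [mul_zero] at this
  obtain ⟨R, hR1, hR2⟩ := ((hRlim.eventually_lt_const (show 0 < δ / 8 by linarith)).and
    (eventually_ge_atTop (max 0 (1 - m)))).exists
  have hR0 : 0 ≤ R := (le_max_left _ _).trans hR2
  have hRm : 1 - m ≤ R := (le_max_right _ _).trans hR2
  set κ := δ / 8 / (M + R + 1) with hκ
  have hκ0 : 0 < κ := by positivity
  have hMRκ : (M + R) * κ ≤ δ / 8 := by
    rw [hκ, mul_div_assoc', div_le_iff₀ (by positivity)]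
    nlinarith
  filter_upwards [hM, h.eventually_ordConnected_le hφ hκ0, h.ne_zero, h.mle, h.data_mem,
    h.tendsto_integral.eventually_const_lt
      (show ∫ y, (φ y).toReal ∂(law φ) - δ / 8 < _ by linarith)]
    with i h1 h2 h3 h4 h5 h6
  by_contra! hcon
  have key := h4.gap_le hφ husc h3 (fun j => interior_subset (h5 j)) h2 h1
    (by linarith : -R ≤ M) hT0 measurableSet_Ioo hJT hJφ hε.le hε1 (fun y hy => ?_)
  · simp only [Pi.sub_apply] at hT1
    linarith
  -- Since `M ≥ φ y + 1` and `-R ≤ φ y - 1` on `(a, b)`, truncation does not destroy a gap of size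
  -- `ε ≤ 1`.
  · by_cases hy1 : (((φ y).toReal - ε : ℝ) : EReal) ≤ g i y
    · have h7 := le_clamp (R := R) (M := M) (hcon y hy hy1).le (by linarith [hub y hy])
      rw [le_abs]
      left
      linarith
    · have h7 := clamp_le_of_le (R := R) (M := M) (not_le.1 hy1).le (by linarith [hm y hy])
      rw [le_abs]
      right
      linarith

end

/-- The extrapolated value is `b + (s / t) * (b - a)`, and `K` bounds the ratio `s / t`. -/
theorem IsConcave.le_extrapolate_of_ratio {g : ℝ → EReal} (hg : IsConcave g) {c x s t a b K : ℝ}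
    (hs : 0 < s) (ht : 0 < t) (hst : s + t = 1) (ha : (a : EReal) ≤ g c)
    (hb : g (s * c + t * x) ≤ (b : EReal)) (hab : a ≤ b) (hK : s ≤ K * t) :
    g x ≤ ((b + K * (b - a) : ℝ) : EReal) := by
  refine (hg.le_extrapolate hs ht hst ha hb).trans (EReal.coe_le_coe_iff.2 ?_)
  rw [div_le_iff₀ ht]
  have h1 : s * (b - a) ≤ K * t * (b - a) := mul_le_mul_of_nonneg_right hK (by linarith)
  have h2 : b = s * b + t * b := by rw [← add_mul, hst, one_mul]
  nlinarith

theorem IsLogConcaveLogDensity.concaveOn_toReal {φ : ℝ → EReal}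
    (hφ : IsLogConcaveLogDensity φ) : ConcaveOn ℝ (dom φ) fun y => (φ y).toReal := by
  have hconv : Convex ℝ (dom φ) := hφ.concave.ordConnected_dom.convex
  refine ⟨hconv, fun y hy z hz s t hs ht hst => ?_⟩
  rcases hs.eq_or_lt with rfl | hs
  · have : t = 1 := by linarith
    simp [this]
  rcases ht.eq_or_lt with rfl | ht
  · have : s = 1 := by linarith
    simp [this]
  have h := hφ.concave.combo_le hs ht hst (coe_toReal_of_mem_dom hφ hy).le
    (coe_toReal_of_mem_dom hφ hz).le
  have hm := hconv hy hz hs.le ht.le hst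
  simp only [smul_eq_mul] at hm ⊢
  rwa [← coe_toReal_of_mem_dom hφ hm, EReal.coe_le_coe_iff] at h

theorem IsLogConcaveLogDensity.continuousOn_toReal {φ : ℝ → EReal}
    (hφ : IsLogConcaveLogDensity φ) :
    ContinuousOn (fun y => (φ y).toReal) (interior (dom φ)) :=
  (hφ.concaveOn_toReal.subset interior_subset
    (ordConnected_interior_dom hφ.concave).convex).continuousOn isOpen_interior

section

variable {ι : Type*} {l : Filter ι} {φ : ℝ → EReal} {N : ι → ℕ} {x : ∀ i, Fin (N i) → ℝ}
  {g : ι → ℝ → EReal}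

theorem exists_Ioo_close {φ : ℝ → EReal} (hφ : IsLogConcaveLogDensity φ) {y : ℝ}
    (hy : y ∈ interior (dom φ)) {ε : ℝ} (hε : 0 < ε) :
    ∃ h : ℝ, 0 < h ∧ ∀ z, |z - y| ≤ h →
      z ∈ interior (dom φ) ∧ |(φ z).toReal - (φ y).toReal| < ε := by
  have h1 : ∀ᶠ z in 𝓝 y, z ∈ interior (dom φ) ∧ |(φ z).toReal - (φ y).toReal| < ε := by
    have hU : ∀ᶠ z in 𝓝 y, z ∈ interior (dom φ) := isOpen_interior.eventually_mem hy
    refine hU.and ?_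
    have := hφ.continuousOn_toReal.continuousAt (isOpen_interior.mem_nhds hy)
    exact (Metric.tendsto_nhds.1 this) ε hε
  obtain ⟨h, h0, hh⟩ := Metric.eventually_nhds_iff.1 h1
  refine ⟨h / 2, by linarith, fun z hz => hh ?_⟩
  rw [Real.dist_eq]
  linarith

/-- Points of closeness on both sides of `y`, with concavity in between and continuity of `φ`. -/
theorem EmpiricalConvergence.eventually_ge (h : EmpiricalConvergence l φ x g)
    (hφ : IsLogConcaveLogDensity φ) (husc : UpperSemicontinuous φ) {y : ℝ}
    (hy : y ∈ interior (dom φ)) {ε : ℝ} (hε : 0 < ε) :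
    ∀ᶠ i in l, (((φ y).toReal - ε : ℝ) : EReal) ≤ g i y := by
  obtain ⟨r, hr, hclose⟩ := exists_Ioo_close hφ hy (half_pos hε)
  have hd : ∀ z, |z - y| ≤ r → z ∈ dom φ := fun z hz => interior_subset (hclose z hz).1
  have hyd := interior_subset hy
  filter_upwards [h.mle,
    h.exists_near hφ husc (show y - r < y by linarith)
      (hd _ (by simp [abs_of_pos hr])) hyd (half_pos hε),
    h.exists_near hφ husc (show y < y + r by linarith) hyd
      (hd _ (by simp [abs_of_pos hr])) (half_pos hε)]
    with i hi ⟨y₁, hy₁, h1, _⟩ ⟨y₂, hy₂, h2, _⟩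
  refine (hi.1.concave.ordConnected_le _).out ?_ ?_ ⟨hy₁.2.le, hy₂.1.le⟩
  · refine le_trans (EReal.coe_le_coe_iff.2 ?_) h1
    have := (hclose y₁ (abs_le.2 ⟨by linarith [hy₁.1], by linarith [hy₁.2]⟩)).2
    linarith [(abs_lt.1 this).1]
  · refine le_trans (EReal.coe_le_coe_iff.2 ?_) h2
    have := (hclose y₂ (abs_le.2 ⟨by linarith [hy₂.1], by linarith [hy₂.2]⟩)).2
    linarith [(abs_lt.1 this).1]

/-- Extrapolation to `y` from two points of closeness on its left. They are at least `r / 3` apart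
and the nearer one is within `r / 3` of `y`, so the ratio is at most `1` and the error is `ε / 3 + 2
* ε / 3`. -/
theorem EmpiricalConvergence.eventually_le (h : EmpiricalConvergence l φ x g)
    (hφ : IsLogConcaveLogDensity φ) (husc : UpperSemicontinuous φ) {y : ℝ}
    (hy : y ∈ interior (dom φ)) {ε : ℝ} (hε : 0 < ε) :
    ∀ᶠ i in l, g i y ≤ (((φ y).toReal + ε : ℝ) : EReal) := by
  obtain ⟨r, hr, hclose⟩ := exists_Ioo_close hφ hy (show 0 < ε / 6 by linarith)
  have hd : ∀ z, |z - y| ≤ r → z ∈ dom φ := fun z hz => interior_subset (hclose z hz).1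
  have hyd := interior_subset hy
  filter_upwards [h.mle,
    h.exists_near hφ husc (show y - r < y - 2 * r / 3 by linarith)
      (hd _ (by simp [abs_of_pos hr])) (hd _ (abs_le.2 ⟨by linarith, by linarith⟩))
      (show 0 < ε / 6 by linarith),
    h.exists_near hφ husc (show y - r / 3 < y by linarith)
      (hd _ (abs_le.2 ⟨by linarith, by linarith⟩)) hyd (show 0 < ε / 6 by linarith)]
    with i hi ⟨y₁, hy₁, h1, _⟩ ⟨y₂, hy₂, _, h2⟩
  have c1 := (abs_lt.1 (hclose y₁ (abs_le.2 ⟨by linarith [hy₁.1], by linarith [hy₁.2]⟩)).2)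
  have c2 := (abs_lt.1 (hclose y₂ (abs_le.2 ⟨by linarith [hy₂.1], by linarith [hy₂.2]⟩)).2)
  have hlt : 0 < y - y₁ := by linarith [hy₁.2]
  have key := hi.1.concave.le_extrapolate_of_ratio (c := y₁) (x := y) (s := (y - y₂) / (y - y₁))
    (t := (y₂ - y₁) / (y - y₁)) (a := (φ y).toReal - ε / 3) (b := (φ y).toReal + ε / 3) (K := 1)
    (div_pos (by linarith [hy₂.2]) hlt) (div_pos (by linarith [hy₂.1, hy₁.2]) hlt)
    (by field_simp; ring) (le_trans (EReal.coe_le_coe_iff.2 (by linarith)) h1) (by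
      have : (y - y₂) / (y - y₁) * y₁ + (y₂ - y₁) / (y - y₁) * y = y₂ := by field_simp; ring
      rw [this]
      exact h2.trans (EReal.coe_le_coe_iff.2 (by linarith))) (by linarith) (by
      rw [one_mul]
      exact div_le_div_of_nonneg_right (by linarith [hy₂.1, hy₁.2]) hlt.le)
  exact key.trans (EReal.coe_le_coe_iff.2 (by linarith))

end

/-! ### The estimator vanishes off closed intervals containing the data in their interior -/

theorem IsLogConcaveLogDensity.exists_ne_mem_dom {φ : ℝ → EReal} (hφ : IsLogConcaveLogDensity φ)
    (y : ℝ) : ∃ z ∈ dom φ, z ≠ y := by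
  obtain ⟨a, ha, b, hb, hab⟩ := hφ.exists_lt_dom
  by_cases h : a = y
  · exact ⟨b, hb, by rw [← h]; exact hab.ne'⟩
  · exact ⟨a, ha, h⟩

theorem law_pos_of_mem_nhds {g : ℝ → EReal} (hg : IsLogConcaveLogDensity g) {p : ℝ}
    (hp : p ∈ dom g) {V : Set ℝ} (hV : V ∈ 𝓝 p) : 0 < law g V := by
  obtain ⟨a, b, hab, hsub⟩ := mem_nhds_iff_exists_Ioo_subset.1 hV
  obtain ⟨q, hq, hqp⟩ := hg.exists_ne_mem_dom p
  have ho := hg.concave.ordConnected_dom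
  rcases lt_or_gt_of_ne hqp with h | h
  · refine law_pos_of_Ioo_subset hg (a := max a q) (b := p) (max_lt hab.1 h) ?_ ?_
    · exact (Ioo_subset_Ioo (le_max_left _ _) hab.2.le).trans hsub
    · exact (Ioo_subset_Ioo_left (le_max_right _ _)).trans
        (Ioo_subset_Icc_self.trans (ho.out hq hp))
  · refine law_pos_of_Ioo_subset hg (a := p) (b := min b q) (lt_min hab.2 h) ?_ ?_
    · exact (Ioo_subset_Ioo hab.1.le (min_le_left _ _)).trans hsub
    · exact (Ioo_subset_Ioo_right (min_le_right _ _)).trans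
        (Ioo_subset_Icc_self.trans (ho.out hp hq))

open scoped Classical in
/-- The function `g + c` on `S`, and `-∞` outside `S`. -/
noncomputable def restrictAdd (g : ℝ → EReal) (S : Set ℝ) (c : ℝ) (y : ℝ) : EReal :=
  if y ∈ S then g y + (c : EReal) else ⊥

theorem IsConcave.restrictAdd {g : ℝ → EReal} (hg : IsConcave g) (hlt : ∀ y, g y < ⊤) {S : Set ℝ}
    (hS : OrdConnected S) (c : ℝ) : IsConcave (restrictAdd g S c) := by
  intro a b s t hs ht hst
  unfold LogConcaveTails.restrictAdd
  by_cases ha : a ∈ S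
  · by_cases hb : b ∈ S
    · have hab : s * a + t * b ∈ S := hS.convex ha hb hs.le ht.le hst
      rw [if_pos ha, if_pos hb, if_pos hab]
      by_cases ha' : a ∈ dom g
      · by_cases hb' : b ∈ dom g
        · have ea : ((g a).toReal : EReal) = g a := EReal.coe_toReal (hlt a).ne ha'.ne'
          have eb : ((g b).toReal : EReal) = g b := EReal.coe_toReal (hlt b).ne hb'.ne'
          have h := hg.combo_le hs ht hst ea.le eb.le
          rw [← ea, ← eb]
          refine le_trans (le_of_eq ?_) (add_le_add_left h (c : EReal))
          norm_cast
          calc s * ((g a).toReal + c) + t * ((g b).toReal + c)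
              = s * (g a).toReal + t * (g b).toReal + (s + t) * c := by ring
            _ = _ := by rw [hst, one_mul]
        · rw [notMem_dom_iff.1 hb', EReal.bot_add, EReal.coe_mul_bot_of_pos ht, EReal.add_bot]
          exact bot_le
      · rw [notMem_dom_iff.1 ha', EReal.bot_add, EReal.coe_mul_bot_of_pos hs, EReal.bot_add]
        exact bot_le
    · rw [if_neg hb, EReal.coe_mul_bot_of_pos ht, EReal.add_bot]
      exact bot_le
  · rw [if_neg ha, EReal.coe_mul_bot_of_pos hs, EReal.bot_add]
    exact bot_le

theorem IsLogConcaveLogDensity.restrictAdd {g : ℝ → EReal} (hg : IsLogConcaveLogDensity g)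
    {S : Set ℝ} (hS : OrdConnected S) (h0 : law g S ≠ 0) :
    IsLogConcaveLogDensity (restrictAdd g S (-Real.log (law g S).toReal)) := by
  have := hg.isProbabilityMeasure
  have hZ : 0 < (law g S).toReal := ENNReal.toReal_pos h0 (measure_ne_top _ _)
  set c := -Real.log (law g S).toReal with hc
  refine ⟨fun y => ?_, hg.concave.restrictAdd hg.lt_top hS c, ?_⟩
  · unfold LogConcaveTails.restrictAdd
    split_ifs
    · exact EReal.add_lt_top (hg.lt_top y).ne (EReal.coe_ne_top c)
    · exact bot_lt_top
  · have e : (fun y => EReal.exp (LogConcaveTails.restrictAdd g S c y))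
        = S.indicator fun y => EReal.exp (g y) * EReal.exp (c : EReal) := by
      ext y
      unfold LogConcaveTails.restrictAdd
      by_cases hy : y ∈ S
      · rw [if_pos hy, indicator_of_mem hy, EReal.exp_add]
      · rw [if_neg hy, indicator_of_notMem hy, EReal.exp_bot]
    rw [e, lintegral_indicator hS.measurableSet, lintegral_mul_const _ hg.measurable_exp,
      ← withDensity_apply _ hS.measurableSet]
    change law g S * _ = 1
    rw [EReal.exp_coe, hc, Real.exp_neg, Real.exp_log hZ, ENNReal.ofReal_inv_of_pos hZ,
      ENNReal.ofReal_toReal (measure_ne_top _ _)]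
    exact ENNReal.mul_inv_cancel h0 (measure_ne_top _ _)

/-- Finiteness at some `y ∉ S` would give `Sᶜ` positive mass. Conditioning on `S` would then add the
positive constant `-log (law g S)` at every data point and beat the maximizer. -/
theorem IsLogConcaveMLE.eq_bot_of_notMem {n : ℕ} {x : Fin n → ℝ} {g : ℝ → EReal}
    (hg : IsLogConcaveMLE x g) (hn : n ≠ 0) {S : Set ℝ} (hSo : OrdConnected S) (hSc : IsClosed S)
    (hx : ∀ j, x j ∈ interior S) (hdom : ∀ j, x j ∈ dom g) {y : ℝ} (hy : y ∉ S) : g y = ⊥ := by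
  by_contra hne
  have hyd : y ∈ dom g := bot_lt_iff_ne_bot.2 hne
  have := hg.1.isProbabilityMeasure
  have j₀ : Fin n := ⟨0, Nat.pos_of_ne_zero hn⟩
  have h0 : 0 < law g S := law_pos_of_mem_nhds hg.1 (hdom j₀) (mem_interior_iff_mem_nhds.1 (hx j₀))
  have h1 : 0 < law g Sᶜ := law_pos_of_mem_nhds hg.1 hyd (hSc.isOpen_compl.mem_nhds hy)
  have hlt : (law g).real S < 1 := by
    have h2 : 0 < (law g).real Sᶜ := ENNReal.toReal_pos h1.ne' (measure_ne_top _ _)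
    rw [probReal_compl_eq_one_sub hSc.measurableSet] at h2
    linarith
  have hpos : 0 < (law g).real S := ENNReal.toReal_pos h0.ne' (measure_ne_top _ _)
  have hψ := hg.2 _ (hg.1.restrictAdd hSo h0.ne')
  set c := -Real.log (law g S).toReal with hc
  have hc0 : 0 < c := by
    have := Real.log_neg hpos hlt
    rw [measureReal_def] at this
    linarith
  have e1 : ∑ j, restrictAdd g S c (x j) = ((∑ j, ((g (x j)).toReal + c) : ℝ) : EReal) := by
    rw [coe_sum_ereal]
    refine Finset.sum_congr rfl fun j _ => ?_
    rw [restrictAdd, if_pos (interior_subset (hx j)), EReal.coe_add,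
      coe_toReal_of_mem_dom hg.1 (hdom j)]
  have e2 : ∑ j, g (x j) = ((∑ j, (g (x j)).toReal : ℝ) : EReal) := by
    rw [coe_sum_ereal]
    exact Finset.sum_congr rfl fun j _ => (coe_toReal_of_mem_dom hg.1 (hdom j)).symm
  rw [e1, e2, EReal.coe_le_coe_iff, Finset.sum_add_distrib, Finset.sum_const, Finset.card_univ,
    Fintype.card_fin, nsmul_eq_mul] at hψ
  have : 0 < (n : ℝ) * c := mul_pos (by exact_mod_cast Nat.pos_of_ne_zero hn) hc0
  linarith

/-! ### Right derivatives -/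

theorem IsLogConcaveLogDensity.rightDeriv_le {g : ℝ → EReal} (hg : IsLogConcaveLogDensity g)
    {c d b s C D : ℝ} (hcd : c < d) (hdb : d < b) (hC : (C : EReal) ≤ g c) (hD : g d ≤ D)
    (hs : D - C ≤ s * (d - c)) : rightDeriv g b ≤ s := by
  refine limsup_le_of_le (by isBoundedDefault) ?_
  filter_upwards [self_mem_nhdsWithin] with y hy
  have hby : b < y := hy
  have hyb : 0 < y - b := by linarith
  by_cases hyd : y ∈ dom g
  · have hcd' : c ∈ dom g := mem_dom_iff.2 ⟨C, hC⟩
    have ho := hg.concave.ordConnected_dom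
    have hbd : b ∈ dom g := ho.out hcd' hyd ⟨by linarith, hby.le⟩
    have hdd : d ∈ dom g := ho.out hcd' hyd ⟨hcd.le, by linarith⟩
    have h1 := hg.concaveOn_toReal.slope_anti_adjacent hcd' hbd hcd hdb
    have h2 := hg.concaveOn_toReal.slope_anti_adjacent hdd hyd hdb hby
    have h3 : ((g d).toReal - (g c).toReal) / (d - c) ≤ s := by
      rw [div_le_iff₀ (by linarith)]
      rw [← coe_toReal_of_mem_dom hg hcd', EReal.coe_le_coe_iff] at hC
      rw [← coe_toReal_of_mem_dom hg hdd, EReal.coe_le_coe_iff] at hD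
      linarith
    rw [← coe_toReal_of_mem_dom hg hyd, ← coe_toReal_of_mem_dom hg hbd]
    rw [← EReal.coe_sub, ← EReal.coe_div, EReal.coe_le_coe_iff]
    exact h2.trans (h1.trans h3)
  -- Here `g b` may be `⊥` too; since `⊥ - ⊥ = ⊥` in `EReal`, the quotient is still `⊥`.
  · rw [notMem_dom_iff.1 hyd, EReal.bot_sub,
      EReal.bot_div_of_pos_ne_top (by exact_mod_cast hyb) (EReal.coe_ne_top _)]
    exact bot_le

theorem coe_lt_rightEnd {φ : ℝ → EReal} (hφ : IsLogConcaveLogDensity φ) {u : ℝ}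
    (hu : u ∈ interior (dom φ)) : (u : EReal) < rightEnd (law φ) := by
  obtain ⟨a, b, hab, hsub⟩ := mem_nhds_iff_exists_Ioo_subset.1 (isOpen_interior.mem_nhds hu)
  obtain ⟨v, hv1, hv2⟩ := exists_between hab.2
  refine lt_of_lt_of_le (EReal.coe_lt_coe_iff.2 hv1) ?_
  rw [rightEnd, cdfSupport_law hφ]
  exact le_sSup (mem_image_of_mem _ (hsub ⟨hab.1.trans hv1, hv2⟩))

/-- Unfolds the two nested limits: a point `c` near the right end with right derivative below `s`,
then a point `d` just after it with difference quotient below `s`. -/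
theorem exists_slope_lt {φ : ℝ → EReal} (hφ : IsLogConcaveLogDensity φ) {s : ℝ}
    (hs : derivLeftLim φ (rightEnd (law φ)) < s) :
    ∃ c ∈ interior (dom φ), ∃ d ∈ interior (dom φ), c < d ∧
      (φ d).toReal - (φ c).toReal < s * (d - c) := by
  set r := rightEnd (law φ) with hr
  have hr' : r = sSup (Real.toEReal '' interior (dom φ)) := by
    rw [hr, rightEnd, cdfSupport_law hφ]
  have hUr : ∀ u ∈ interior (dom φ), (u : EReal) < r := fun u hu => coe_lt_rightEnd hφ hu
  obtain ⟨u, hu⟩ := hφ.interior_dom_nonempty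
  have hmem : ∀ᶠ y in comap Real.toEReal (𝓝[<] r), y ∈ interior (dom φ) := by
    refine mem_comap.2 ⟨Ioo (u : EReal) r, Ioo_mem_nhdsLT (hUr u hu), ?_⟩
    intro y hy
    have hyr : (y : EReal) < sSup (Real.toEReal '' interior (dom φ)) := by rw [← hr']; exact hy.2
    obtain ⟨_, ⟨v, hv, rfl⟩, hyv⟩ := lt_sSup_iff.1 hyr
    exact (ordConnected_interior_dom hφ.concave).out hu hv
      ⟨(EReal.coe_lt_coe_iff.1 hy.1).le, (EReal.coe_lt_coe_iff.1 hyv).le⟩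
  have hne : (comap Real.toEReal (𝓝[<] r)).NeBot := by
    refine comap_neBot fun t ht => ?_
    obtain ⟨a, ha, hat⟩ := (mem_nhdsLT_iff_exists_Ioo_subset' (hUr u hu)).1 ht
    obtain ⟨v, hv1, hv2⟩ := EReal.lt_iff_exists_real_btwn.1 (show a < r from ha)
    exact ⟨v, hat ⟨hv1, hv2⟩⟩
  have hlt : ∀ᶠ y in comap Real.toEReal (𝓝[<] r), rightDeriv φ y < s :=
    eventually_lt_of_limsup_lt hs
  obtain ⟨c, hc1, hc2⟩ := (hlt.and hmem).exists
  have hlt' : ∀ᶠ z in 𝓝[>] c, (φ z - φ c) / ((z - c : ℝ) : EReal) < s :=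
    eventually_lt_of_limsup_lt hc1
  obtain ⟨d, ⟨hd1, hd2⟩, hd3⟩ := ((hlt'.and
    (mem_nhdsWithin_of_mem_nhds (isOpen_interior.mem_nhds hc2))).and self_mem_nhdsWithin).exists
  have hcd : c < d := hd3
  refine ⟨c, hc2, d, hd2, hcd, ?_⟩
  rw [← coe_toReal_of_mem_dom hφ (interior_subset hd2),
    ← coe_toReal_of_mem_dom hφ (interior_subset hc2), ← EReal.coe_sub, ← EReal.coe_div,
    EReal.coe_lt_coe_iff, div_lt_iff₀ (by linarith)] at hd1
  exact hd1

section

variable {ι : Type*} {l : Filter ι} {φ : ℝ → EReal} {N : ι → ℕ} {x : ∀ i, Fin (N i) → ℝ}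
  {g : ι → ℝ → EReal}

/-- Pointwise convergence at `c` and `d` carries the chord slope over to the estimator, each end
point using half of the strict slack. The bound is uniform in `b > d`, so moving points `b n` are
covered. -/
theorem EmpiricalConvergence.eventually_estRightDeriv_le (h : EmpiricalConvergence l φ x g)
    (hφ : IsLogConcaveLogDensity φ) (husc : UpperSemicontinuous φ) {s : ℝ}
    (hs : derivLeftLim φ (rightEnd (law φ)) < s) :
    ∃ d ∈ interior (dom φ), ∀ᶠ i in l, ∀ b, d < b → estRightDeriv (x i) (g i) b ≤ s := by
  obtain ⟨c, hc, d, hd, hcd, hlt⟩ := exists_slope_lt hφ hs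
  refine ⟨d, hd, ?_⟩
  set ε := (s * (d - c) - ((φ d).toReal - (φ c).toReal)) / 2 with hε
  have hε0 : 0 < ε := by rw [hε]; linarith
  filter_upwards [h.mle, h.eventually_ge hφ husc hc hε0, h.eventually_le hφ husc hd hε0]
    with i h1 h2 h3 b hdb
  rw [estRightDeriv]
  split_ifs
  · exact bot_le
  · exact h1.1.rightDeriv_le hcd hdb h2 h3 (by rw [hε]; linarith)

end

/-! ### Uniform upper bound for the estimated density -/

theorem add_mul_mem_interior_dom {φ : ℝ → EReal} (hφ : IsConcave φ) {y z τ : ℝ} (hy : y ∈ dom φ)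
    (hz : z ∈ dom φ) (hyz : z ≠ y) (h0 : 0 < τ) (h1 : τ < 1) :
    y + τ * (z - y) ∈ interior (dom φ) := by
  rcases lt_or_gt_of_ne hyz with h | h
  · exact Ioo_subset_interior_dom hφ hz hy ⟨by nlinarith, by nlinarith⟩
  · exact Ioo_subset_interior_dom hφ hy hz ⟨by nlinarith, by nlinarith⟩

theorem IsLogConcaveLogDensity.eventually_ge_of_mem_uIcc {φ : ℝ → EReal}
    (hφ : IsLogConcaveLogDensity φ) {y w ε : ℝ} (hy : y ∈ dom φ) (hw : w ∈ dom φ) (hwy : w ≠ y)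
    (hε : 0 < ε) :
    ∀ᶠ z in 𝓝 y, z ∈ uIcc y w → (((φ y).toReal - ε : ℝ) : EReal) ≤ φ z := by
  set m : ℝ → ℝ := fun z => (φ y).toReal + (z - y) / (w - y) * ((φ w).toReal - (φ y).toReal)
    with hm
  have hcont : Continuous m := by
    rw [hm]
    fun_prop
  have hlim : Tendsto m (𝓝 y) (𝓝 ((φ y).toReal)) := by
    have := hcont.tendsto y
    simpa [hm] using this
  filter_upwards [hlim.eventually_const_le (show (φ y).toReal - ε < (φ y).toReal by linarith)]
    with z hz hzu
  have hzd : z ∈ dom φ := hφ.concave.ordConnected_dom.uIcc_subset hy hw hzu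
  rw [← coe_toReal_of_mem_dom hφ hzd, EReal.coe_le_coe_iff]
  refine hz.trans ?_
  have hwy' : w - y ≠ 0 := sub_ne_zero.2 hwy
  obtain ⟨h0, h1⟩ : 0 ≤ (z - y) / (w - y) ∧ (z - y) / (w - y) ≤ 1 := by
    rcases lt_or_gt_of_ne hwy with h | h
    · rw [uIcc_of_ge h.le] at hzu
      constructor
      · exact div_nonneg_of_nonpos (by linarith [hzu.2]) (by linarith)
      · rw [div_le_one_of_neg (by linarith)]; linarith [hzu.1]
    · rw [uIcc_of_le h.le] at hzu
      constructor
      · exact div_nonneg (by linarith [hzu.1]) (by linarith)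
      · rw [div_le_one (by linarith)]; linarith [hzu.2]
  have h2 := hφ.concaveOn_toReal.2 hy hw (sub_nonneg.2 h1) h0 (by ring)
  have h3 : (1 - (z - y) / (w - y)) • y + ((z - y) / (w - y)) • w = z := by
    simp only [smul_eq_mul]; field_simp; ring
  rw [h3] at h2
  simp only [smul_eq_mul] at h2
  rw [hm]
  linarith

/-- Chords give lower semicontinuity from each side on which `dom φ` has points; on any other side
its closure has none either. -/
theorem IsLogConcaveLogDensity.eventually_ge_of_mem_closure {φ : ℝ → EReal}
    (hφ : IsLogConcaveLogDensity φ) {y ε : ℝ} (hy : y ∈ dom φ) (hε : 0 < ε) :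
    ∀ᶠ z in 𝓝 y, z ∈ closure (dom φ) → (((φ y).toReal - ε : ℝ) : EReal) ≤ φ z := by
  have hr : ∀ᶠ z in 𝓝 y, y < z → z ∈ closure (dom φ) →
      (((φ y).toReal - ε : ℝ) : EReal) ≤ φ z := by
    by_cases h : ∃ w ∈ dom φ, y < w
    · obtain ⟨w, hw, hyw⟩ := h
      filter_upwards [hφ.eventually_ge_of_mem_uIcc hy hw hyw.ne' hε, Iio_mem_nhds hyw]
        with z hz hzw hyz _
      exact hz (by rw [uIcc_of_le hyw.le]; exact ⟨hyz.le, le_of_lt hzw⟩)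
    · push Not at h
      refine Eventually.of_forall fun z hyz hz => ?_
      exact absurd (closure_minimal h isClosed_Iic hz) (not_le.2 hyz)
  have hl : ∀ᶠ z in 𝓝 y, z < y → z ∈ closure (dom φ) →
      (((φ y).toReal - ε : ℝ) : EReal) ≤ φ z := by
    by_cases h : ∃ w ∈ dom φ, w < y
    · obtain ⟨w, hw, hyw⟩ := h
      filter_upwards [hφ.eventually_ge_of_mem_uIcc hy hw hyw.ne hε, Ioi_mem_nhds hyw]
        with z hz hzw hyz _
      exact hz (by rw [uIcc_of_ge hyw.le]; exact ⟨le_of_lt hzw, hyz.le⟩)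
    · push Not at h
      refine Eventually.of_forall fun z hyz hz => ?_
      exact absurd (closure_minimal h isClosed_Ici hz) (not_le.2 hyz)
  filter_upwards [hl, hr] with z h1 h2 hz
  rcases lt_trichotomy z y with h | rfl | h
  · exact h1 h hz
  · rw [← coe_toReal_of_mem_dom hφ hy, EReal.toReal_coe, EReal.coe_le_coe_iff]
    linarith
  · exact h2 h hz

section

variable {ι : Type*} {l : Filter ι} {φ : ℝ → EReal} {N : ι → ℕ} {x : ∀ i, Fin (N i) → ℝ}
  {g : ι → ℝ → EReal}

/-- The point `y` may be an end point of `dom φ`, where pointwise convergence is unknown. The bound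
is extrapolated from interior points `c` and `d` at distances in ratio `2 : 1` from `y`; the ratio
`s / t = (σ - r) / σ` is at most `2`, and the errors add up to `ε / 5 + 2 * (2 * ε / 5) = ε`. -/
theorem EmpiricalConvergence.eventually_le_near (h : EmpiricalConvergence l φ x g)
    (hφ : IsLogConcaveLogDensity φ) (husc : UpperSemicontinuous φ) {y ε : ℝ} (hy : y ∈ dom φ)
    (hε : 0 < ε) :
    ∃ V ∈ 𝓝 y, ∀ᶠ i in l, ∀ z ∈ V, g i z ≤ (((φ y).toReal + ε : ℝ) : EReal) := by
  obtain ⟨w, hw, hwy⟩ := hφ.exists_ne_mem_dom y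
  have hw0 : w - y ≠ 0 := sub_ne_zero.2 hwy
  have hε' : 0 < ε / 10 := by linarith
  have hyc := coe_toReal_of_mem_dom hφ hy
  have hd_ev : ∀ᶠ z in 𝓝 y, φ z < (((φ y).toReal + ε / 10 : ℝ) : EReal) := by
    refine husc y _ (lt_of_eq_of_lt hyc.symm (EReal.coe_lt_coe_iff.2 ?_))
    linarith
  have hlim : ∀ k : ℝ, Tendsto (fun σ : ℝ => y + k * σ * (w - y)) (𝓝[>] 0) (𝓝 y) := by
    intro k
    have : Continuous fun σ : ℝ => y + k * σ * (w - y) := by fun_prop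
    have := this.tendsto 0
    simp only [mul_zero, zero_mul, add_zero] at this
    exact this.mono_left nhdsWithin_le_nhds
  have hhalf : ∀ᶠ σ : ℝ in 𝓝[>] 0, 0 < σ ∧ σ < 1 / 2 :=
    Ioo_mem_nhdsGT (by norm_num)
  obtain ⟨σ, ⟨hσ1, hσ2⟩, hσ0, hσ⟩ := (((hlim 1).eventually hd_ev).and
    ((hlim 2).eventually (hφ.eventually_ge_of_mem_uIcc hy hw hwy hε')) |>.and hhalf).exists
  set d := y + σ * (w - y) with hd
  set c := y + 2 * σ * (w - y) with hc
  have hdU : d ∈ interior (dom φ) := add_mul_mem_interior_dom hφ.concave hy hw hwy hσ0 (by linarith)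
  have hcU : c ∈ interior (dom φ) :=
    add_mul_mem_interior_dom hφ.concave hy hw hwy (by linarith) (by linarith)
  have hcge : (φ y).toReal - ε / 10 ≤ (φ c).toReal := by
    rw [← EReal.coe_le_coe_iff, coe_toReal_of_mem_dom hφ (interior_subset hcU)]
    refine hσ2 ?_
    rw [mem_uIcc]
    rcases lt_or_gt_of_ne hwy with hlt | hlt
    · right; constructor <;> nlinarith
    · left; constructor <;> nlinarith
  have hdle : (φ d).toReal ≤ (φ y).toReal + ε / 10 := by
    rw [← EReal.coe_le_coe_iff, coe_toReal_of_mem_dom hφ (interior_subset hdU)]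
    rw [one_mul] at hσ1
    exact hσ1.le
  refine ⟨Metric.ball y (σ * |w - y|), Metric.ball_mem_nhds _ (mul_pos hσ0 (abs_pos.2 hw0)), ?_⟩
  filter_upwards [h.mle, h.eventually_ge hφ husc hcU hε', h.eventually_le hφ husc hdU hε']
    with i h1 h2 h3 z hz
  set r := (z - y) / (w - y) with hr
  have hzr : z = y + r * (w - y) := by rw [hr]; field_simp; ring
  have hrσ : |r| < σ := by
    rw [Metric.mem_ball, Real.dist_eq] at hz
    rw [hr, abs_div, div_lt_iff₀ (abs_pos.2 hw0)]
    exact hz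
  obtain ⟨hr1, hr2⟩ := abs_lt.1 hrσ
  have hden : 0 < 2 * σ - r := by linarith
  have hden0 : 2 * σ - r ≠ 0 := hden.ne'
  have key := h1.1.concave.le_extrapolate_of_ratio (c := c) (x := z) (s := (σ - r) / (2 * σ - r))
    (t := σ / (2 * σ - r)) (a := (φ y).toReal - 2 * (ε / 10)) (b := (φ y).toReal + 2 * (ε / 10))
    (K := 2) (div_pos (by linarith) hden) (div_pos hσ0 hden)
    (by rw [← add_div, div_eq_one_iff_eq hden0]; ring)
    (le_trans (EReal.coe_le_coe_iff.2 (by linarith)) h2) (by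
      have : (σ - r) / (2 * σ - r) * c + σ / (2 * σ - r) * z = d := by
        rw [div_mul_eq_mul_div, div_mul_eq_mul_div, ← add_div, div_eq_iff hden0, hzr, hc, hd]
        ring
      rw [this]
      exact h3.trans (EReal.coe_le_coe_iff.2 (by linarith))) (by linarith) (by
      rw [← mul_div_assoc]
      exact div_le_div_of_nonneg_right (by linarith) hden.le)
  exact key.trans (EReal.coe_le_coe_iff.2 (by linarith))

/-- A level `k` strictly between `φ d` and `min m (φ c)` is eventually below the estimator at `c`
and above it at `d`; quasi-concavity does the rest. -/
theorem EmpiricalConvergence.eventually_le_beyond (h : EmpiricalConvergence l φ x g)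
    (hφ : IsLogConcaveLogDensity φ) (husc : UpperSemicontinuous φ) {c d m : ℝ}
    (hc : c ∈ interior (dom φ)) (hd : d ∈ interior (dom φ)) (hdm : φ d < m)
    (hdc : φ d < φ c) :
    ∀ᶠ i in l, ∀ z, (c < d ∧ d ≤ z ∨ z ≤ d ∧ d < c) → g i z ≤ m := by
  rw [← coe_toReal_of_mem_dom hφ (interior_subset hd)] at hdm hdc
  rw [← coe_toReal_of_mem_dom hφ (interior_subset hc)] at hdc
  rw [EReal.coe_lt_coe_iff] at hdm hdc
  obtain ⟨k, hk1, hk2⟩ := exists_between (lt_min hdm hdc)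
  have hkm := hk2.trans_le (min_le_left _ _)
  have hkc := hk2.trans_le (min_le_right _ _)
  filter_upwards [h.mle, h.eventually_ge hφ husc hc (sub_pos.2 hkc),
    h.eventually_le hφ husc hd (sub_pos.2 hk1)] with i h1 h2 h3 z hz
  rw [sub_sub_cancel] at h2
  rw [add_sub_cancel] at h3
  exact (h1.1.concave.le_of_beyond h2 h3 hz).trans (EReal.coe_le_coe_iff.2 hkm.le)

theorem EmpiricalConvergence.eventually_eq_bot (h : EmpiricalConvergence l φ x g)
    (hφ : IsLogConcaveLogDensity φ) : ∀ᶠ i in l, ∀ z, z ∉ closure (dom φ) → g i z = ⊥ := by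
  filter_upwards [h.mle, h.ne_zero, h.data_mem] with i h1 h2 h3 z hz
  exact h1.eq_bot_of_notMem h2 hφ.concave.ordConnected_dom.convex.closure.ordConnected
    isClosed_closure (fun j => interior_mono subset_closure (h3 j))
    (h1.data_mem_dom_and_sum_le hφ fun j => interior_subset (h3 j)).1 hz

/-- At such an end point `φ y = ⊥`, so upper semicontinuity provides an interior `d` near `y` where
`φ` is already very low. -/
theorem EmpiricalConvergence.eventually_le_near_boundary (h : EmpiricalConvergence l φ x g)
    (hφ : IsLogConcaveLogDensity φ) (husc : UpperSemicontinuous φ) {y : ℝ}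
    (hy : y ∈ closure (dom φ)) (hyd : y ∉ dom φ) (m : ℝ) :
    ∃ V ∈ 𝓝 y, ∀ᶠ i in l, ∀ z ∈ V, g i z ≤ m := by
  obtain ⟨c, hc⟩ := hφ.interior_dom_nonempty
  have hsub := hφ.concave.ordConnected_dom.convex.openSegment_interior_closure_subset_interior hc hy (𝕜 := ℝ)
  have hlow : ∀ᶠ d in 𝓝 y, φ d < m ∧ φ d < φ c := by
    have hb := notMem_dom_iff.1 hyd
    exact (husc y _ (lt_of_eq_of_lt hb (EReal.bot_lt_coe m))).and
      (husc y _ (lt_of_eq_of_lt hb (interior_subset (s := dom φ) hc)))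
  rcases lt_trichotomy c y with hcy | rfl | hcy
  · rw [openSegment_eq_Ioo hcy] at hsub
    have hI : ∀ᶠ d in 𝓝[<] y, d ∈ Ioo c y := Ioo_mem_nhdsLT hcy
    obtain ⟨d, ⟨h1, h2⟩, hd⟩ := ((hlow.filter_mono nhdsWithin_le_nhds).and hI).exists
    refine ⟨Ioi d, Ioi_mem_nhds hd.2, ?_⟩
    filter_upwards [h.eventually_le_beyond hφ husc hc (hsub hd) h1 h2] with i hi z hz
    exact hi z (Or.inl ⟨hd.1, le_of_lt hz⟩)
  · exact absurd (interior_subset hc) hyd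
  · rw [openSegment_symm, openSegment_eq_Ioo hcy] at hsub
    have hI : ∀ᶠ d in 𝓝[>] y, d ∈ Ioo y c := Ioo_mem_nhdsGT hcy
    obtain ⟨d, ⟨h1, h2⟩, hd⟩ := ((hlow.filter_mono nhdsWithin_le_nhds).and hI).exists
    refine ⟨Iio d, Iio_mem_nhds hd.1, ?_⟩
    filter_upwards [h.eventually_le_beyond hφ husc hc (hsub hd) h1 h2] with i hi z hz
    exact hi z (Or.inr ⟨le_of_lt hz, hd.2⟩)

/-- On each side, either `dom φ` reaches far enough for `φ` to have dropped below the level, or its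
closure ends and the estimator is `⊥` beyond. -/
theorem EmpiricalConvergence.exists_tail_bound (h : EmpiricalConvergence l φ x g)
    (hφ : IsLogConcaveLogDensity φ) (husc : UpperSemicontinuous φ) (m : ℝ) :
    ∃ T, ∀ᶠ i in l, ∀ z, T ≤ |z| → g i z ≤ m := by
  obtain ⟨c, hc⟩ := hφ.interior_dom_nonempty
  obtain ⟨α, β, hβ, hαβ⟩ := hφ.exists_exp_bound husc
  set k := min m (φ c).toReal with hk
  set T := max (|c| + 1) ((α - k) / β + 1) with hT
  have hlow : ∀ d, T ≤ |d| → φ d < m ∧ φ d < φ c := by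
    intro d hd
    have h1 : φ d < (k : ℝ) := by
      refine (hαβ d).trans_lt (EReal.coe_lt_coe_iff.2 ?_)
      have h2 : (α - k) / β < |d| := by linarith [le_max_right (|c| + 1) ((α - k) / β + 1)]
      rw [div_lt_iff₀ hβ] at h2
      linarith
    refine ⟨h1.trans_le (EReal.coe_le_coe_iff.2 (min_le_left _ _)), h1.trans_le ?_⟩
    rw [← coe_toReal_of_mem_dom hφ (interior_subset hc), EReal.coe_le_coe_iff]
    exact min_le_right _ _
  have hTc : |c| + 1 ≤ T := le_max_left _ _
  have hT0 : 0 ≤ T := by linarith [abs_nonneg c]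
  have hr : ∃ A, ∀ᶠ i in l, ∀ z, A ≤ z → g i z ≤ m := by
    by_cases hd : ∃ d ∈ interior (dom φ), T ≤ d
    · obtain ⟨d, hdU, hd⟩ := hd
      obtain ⟨h1, h2⟩ := hlow d (hd.trans (le_abs_self d))
      refine ⟨d, ?_⟩
      filter_upwards [h.eventually_le_beyond hφ husc hc hdU h1 h2] with i hi z hz
      exact hi z (Or.inl ⟨by linarith [le_abs_self c], hz⟩)
    · push Not at hd
      have hsub : dom φ ⊆ Iic T := by
        intro d hdd
        by_contra hlt
        rw [mem_Iic, not_le] at hlt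
        obtain ⟨e, he1, he2⟩ := exists_between hlt
        have := hd e (Ioo_subset_interior_dom hφ.concave (interior_subset hc) hdd
          ⟨by linarith [le_abs_self c], he2⟩)
        linarith
      refine ⟨T + 1, ?_⟩
      filter_upwards [h.eventually_eq_bot hφ] with i hi z hz
      rw [hi z fun hz' => by
        have : z ≤ T := closure_minimal hsub isClosed_Iic hz'
        linarith]
      exact bot_le
  have hl : ∃ A, ∀ᶠ i in l, ∀ z, z ≤ A → g i z ≤ m := by
    by_cases hd : ∃ d ∈ interior (dom φ), d ≤ -T
    · obtain ⟨d, hdU, hd⟩ := hd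
      obtain ⟨h1, h2⟩ := hlow d (by linarith [neg_abs_le d])
      refine ⟨d, ?_⟩
      filter_upwards [h.eventually_le_beyond hφ husc hc hdU h1 h2] with i hi z hz
      exact hi z (Or.inr ⟨hz, by linarith [neg_abs_le c]⟩)
    · push Not at hd
      have hsub : dom φ ⊆ Ici (-T) := by
        intro d hdd
        by_contra hlt
        rw [mem_Ici, not_le] at hlt
        obtain ⟨e, he1, he2⟩ := exists_between hlt
        have := hd e (Ioo_subset_interior_dom hφ.concave hdd (interior_subset hc)
          ⟨he1, by linarith [neg_abs_le c]⟩)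
        linarith
      refine ⟨-T - 1, ?_⟩
      filter_upwards [h.eventually_eq_bot hφ] with i hi z hz
      rw [hi z fun hz' => by
        have : -T ≤ z := closure_minimal hsub isClosed_Ici hz'
        linarith]
      exact bot_le
  obtain ⟨A, hA⟩ := hr
  obtain ⟨B, hB⟩ := hl
  refine ⟨max A (-B), ?_⟩
  filter_upwards [hA, hB] with i h1 h2 z hz
  rcases le_total 0 z with h0 | h0
  · rw [abs_of_nonneg h0] at hz
    exact h1 z ((le_max_left _ _).trans hz)
  · rw [abs_of_nonpos h0] at hz
    exact h2 z (by linarith [(le_max_right A (-B)).trans hz])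

theorem exists_exp_le {ε : ℝ} (hε : 0 < ε) :
    ∃ m : ℝ, EReal.exp (m : EReal) ≤ ENNReal.ofReal ε :=
  ⟨Real.log ε, by rw [EReal.exp_coe, Real.exp_log hε]⟩

/-- The restriction to `closure (dom φ)` is essential: `φ` may jump to `⊥` just outside an end
point, so the local upper bound would not compare with `φ z` there. -/
theorem EmpiricalConvergence.exists_nhds_exp_le (h : EmpiricalConvergence l φ x g)
    (hφ : IsLogConcaveLogDensity φ) (husc : UpperSemicontinuous φ) {ε : ℝ} (hε : 0 < ε) (y : ℝ) :
    ∃ V ∈ 𝓝 y, ∀ᶠ i in l, ∀ z ∈ V, z ∈ closure (dom φ) →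
      EReal.exp (g i z) ≤ EReal.exp (φ z) + ENNReal.ofReal ε := by
  by_cases hyc : y ∈ closure (dom φ)
  swap
  · exact ⟨(closure (dom φ))ᶜ, isClosed_closure.isOpen_compl.mem_nhds hyc,
      Eventually.of_forall fun i z hz hz' => absurd hz' hz⟩
  by_cases hyd : y ∈ dom φ
  · set p := (φ y).toReal with hp
    obtain ⟨δ, hδ0, hδ⟩ : ∃ δ : ℝ, 0 < δ ∧ Real.exp (p + δ) ≤ Real.exp (p - δ) + ε := by
      have hc : Continuous fun δ : ℝ => Real.exp (p + δ) - Real.exp (p - δ) := by fun_prop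
      have hlim := hc.tendsto 0
      simp only [add_zero, sub_zero, sub_self] at hlim
      have h1 : ∀ᶠ δ : ℝ in 𝓝[>] 0, Real.exp (p + δ) - Real.exp (p - δ) ≤ ε :=
        (hlim.eventually_le_const hε).filter_mono nhdsWithin_le_nhds
      obtain ⟨δ, h2, h3⟩ := (h1.and self_mem_nhdsWithin).exists
      exact ⟨δ, h3, by linarith⟩
    obtain ⟨V, hV, hev⟩ := h.eventually_le_near hφ husc hyd hδ0
    refine ⟨V ∩ {z | z ∈ closure (dom φ) → ((p - δ : ℝ) : EReal) ≤ φ z},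
      inter_mem hV (hφ.eventually_ge_of_mem_closure hyd hδ0), ?_⟩
    filter_upwards [hev] with i hi z hz hzc
    calc EReal.exp (g i z) ≤ EReal.exp ((p + δ : ℝ) : EReal) := EReal.exp_monotone (hi z hz.1)
      _ ≤ EReal.exp ((p - δ : ℝ) : EReal) + ENNReal.ofReal ε := by
          rw [EReal.exp_coe, EReal.exp_coe, ← ENNReal.ofReal_add (Real.exp_pos _).le hε.le]
          exact ENNReal.ofReal_le_ofReal hδ
      _ ≤ EReal.exp (φ z) + ENNReal.ofReal ε := by
          have := EReal.exp_monotone (hz.2 hzc)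
          gcongr
  · obtain ⟨m, hm⟩ := exists_exp_le hε
    obtain ⟨V, hV, hev⟩ := h.eventually_le_near_boundary hφ husc hyc hyd m
    refine ⟨V, hV, ?_⟩
    filter_upwards [hev] with i hi z hz _
    exact ((EReal.exp_monotone (hi z hz)).trans hm).trans le_add_self

theorem EmpiricalConvergence.eventually_exp_le (h : EmpiricalConvergence l φ x g)
    (hφ : IsLogConcaveLogDensity φ) (husc : UpperSemicontinuous φ) {ε : ℝ} (hε : 0 < ε) :
    ∀ᶠ i in l, ∀ z, EReal.exp (g i z) ≤ EReal.exp (φ z) + ENNReal.ofReal ε := by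
  obtain ⟨m, hm⟩ := exists_exp_le hε
  obtain ⟨T, hT⟩ := h.exists_tail_bound hφ husc m
  have hK : ∀ᶠ i in l, ∀ z ∈ Icc (-T) T, z ∈ closure (dom φ) →
      EReal.exp (g i z) ≤ EReal.exp (φ z) + ENNReal.ofReal ε := by
    refine isCompact_Icc.induction_on (p := fun s => ∀ᶠ i in l, ∀ z ∈ s, z ∈ closure (dom φ) →
      EReal.exp (g i z) ≤ EReal.exp (φ z) + ENNReal.ofReal ε) ?_ ?_ ?_ ?_
    · simp
    · intro s t hst ht
      filter_upwards [ht] with i hi z hz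
      exact hi z (hst hz)
    · intro s t hs ht
      filter_upwards [hs, ht] with i h1 h2 z hz
      exact hz.elim (h1 z) (h2 z)
    · intro y _
      obtain ⟨V, hV, hev⟩ := h.exists_nhds_exp_le hφ husc hε y
      exact ⟨V, mem_nhdsWithin_of_mem_nhds hV, hev⟩
  filter_upwards [hT, hK, h.eventually_eq_bot hφ] with i h1 h2 h3 z
  by_cases hz : z ∈ closure (dom φ)
  · rcases le_total T |z| with hz' | hz'
    · exact ((EReal.exp_monotone (h1 z hz')).trans hm).trans le_add_self
    · exact h2 z (abs_le.1 hz') hz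
  · rw [h3 z hz, EReal.exp_bot]
    exact zero_le

end

/-! ### Convergence in probability along a filter -/

section

/-- The filter of those `S ⊆ ℕ × Ω` for which the event `{ω | (n, ω) ∈ S}` has (inner) probability
tending to one: convergence along this filter is convergence in probability. -/
noncomputable def probFilter {Ω : Type*} [MeasurableSpace Ω] (μ : Measure Ω) : Filter (ℕ × Ω) where
  sets := {S | Tendsto (fun n => μ {ω | (n, ω) ∉ S}) atTop (𝓝 0)}
  univ_sets := by simp
  sets_of_superset {S T} hS hST := by
    refine tendsto_of_tendsto_of_tendsto_of_le_of_le tendsto_const_nhds hS (fun _ => zero_le)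
      fun n => measure_mono fun ω hω hS' => hω (hST hS')
  inter_sets {S T} hS hT := by
    have h := Tendsto.add hS hT
    rw [add_zero] at h
    refine tendsto_of_tendsto_of_tendsto_of_le_of_le tendsto_const_nhds h (fun _ => zero_le)
      fun n => (measure_mono fun ω hω => ?_).trans (measure_union_le _ _)
    by_cases hS' : (n, ω) ∈ S
    · exact Or.inr fun hT' => hω ⟨hS', hT'⟩
    · exact Or.inl hS'

variable {Ω : Type*} [MeasurableSpace Ω] {μ : Measure Ω}

theorem eventually_probFilter_iff {p : ℕ × Ω → Prop} :
    (∀ᶠ q in probFilter μ, p q) ↔ Tendsto (fun n => μ {ω | ¬ p (n, ω)}) atTop (𝓝 0) :=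
  Iff.rfl

theorem eventually_probFilter_of_ae {p : ℕ × Ω → Prop} (n₀ : ℕ)
    (h : ∀ n, n₀ ≤ n → ∀ᵐ ω ∂μ, p (n, ω)) : ∀ᶠ q in probFilter μ, p q := by
  rw [eventually_probFilter_iff]
  refine tendsto_const_nhds.congr' ?_
  filter_upwards [eventually_ge_atTop n₀] with n hn
  exact (ae_iff.1 (h n hn)).symm

theorem tendsto_measure_of_imp {p : ℕ × Ω → Prop} {s : ℕ → Set Ω}
    (hp : ∀ᶠ q in probFilter μ, p q) (h : ∀ n ω, ω ∈ s n → ¬ p (n, ω)) :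
    Tendsto (fun n => μ (s n)) atTop (𝓝 0) :=
  tendsto_of_tendsto_of_tendsto_of_le_of_le tendsto_const_nhds hp (fun _ => zero_le)
    fun n => measure_mono (h n)

theorem tendsto_fst_probFilter : Tendsto Prod.fst (probFilter μ) atTop := by
  refine tendsto_atTop.2 fun n₀ => eventually_probFilter_of_ae n₀ fun n hn => ?_
  exact Eventually.of_forall fun _ => hn

theorem tendsto_probFilter_of_ae [IsFiniteMeasure μ] {f : ℕ → Ω → ℝ} {c : ℝ}
    (hf : ∀ n, AEStronglyMeasurable (f n) μ)
    (h : ∀ᵐ ω ∂μ, Tendsto (fun n => f n ω) atTop (𝓝 c)) :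
    Tendsto (fun q : ℕ × Ω => f q.1 q.2) (probFilter μ) (𝓝 c) := by
  have h1 := tendstoInMeasure_iff_dist.1 (tendstoInMeasure_of_tendsto_ae hf h)
  refine Metric.tendsto_nhds.2 fun ε hε => ?_
  rw [eventually_probFilter_iff]
  simpa only [not_lt] using h1 ε hε

section

variable [IsProbabilityMeasure μ] {φ : ℝ → EReal} {X : ℕ → Ω → ℝ}

/-- The strong law of large numbers, weakened to convergence in probability. -/
theorem tendsto_integral_empirical (hX_law : ∀ i, HasLaw (X i) (law φ) μ)
    (hX_indep : iIndepFun X μ) {h : ℝ → ℝ} (hm : Measurable h) (hi : Integrable h (law φ)) :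
    Tendsto (fun q : ℕ × Ω => ∫ y, h y ∂(empirical fun j : Fin q.1 => X j q.2)) (probFilter μ)
      (𝓝 (∫ y, h y ∂(law φ))) := by
  have hint : Integrable (h ∘ X 0) μ := by
    rw [← integrable_map_measure _ (hX_law 0).aemeasurable, (hX_law 0).map_eq]
    · exact hi
    · exact hm.aestronglyMeasurable
  have hmean : ∫ ω, (h ∘ X 0) ω ∂μ = ∫ y, h y ∂(law φ) :=
    (hX_law 0).integral_comp hm.aestronglyMeasurable
  have hlln := strong_law_ae_real (fun i => h ∘ X i) hint
    (fun i j hij => (hX_indep.indepFun hij).comp hm hm)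
    (fun i => ((hX_law i).identDistrib (hX_law 0)).comp hm)
  rw [hmean] at hlln
  refine (tendsto_probFilter_of_ae (fun n => ?_) hlln).congr fun q => ?_
  · refine AEMeasurable.aestronglyMeasurable (AEMeasurable.div_const ?_ _)
    exact Finset.aemeasurable_fun_sum _ fun i _ => hm.comp_aemeasurable (hX_law i).aemeasurable
  · rw [integral_empirical, Finset.sum_range]
    rfl

theorem empiricalConvergence_probFilter (hφ : IsLogConcaveLogDensity φ)
    (husc : UpperSemicontinuous φ) (hX_law : ∀ i, HasLaw (X i) (law φ) μ)
    (hX_indep : iIndepFun X μ) {φhat : ℕ → Ω → ℝ → EReal}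
    (hφhat : ∀ n : ℕ, 2 ≤ n → ∀ᵐ ω ∂μ,
      IsLogConcaveMLE (fun i : Fin n => X i ω) (φhat n ω)) :
    EmpiricalConvergence (probFilter μ) φ (N := Prod.fst) (fun q j => X j q.2)
      (fun q => φhat q.1 q.2) := by
  have := hφ.isProbabilityMeasure
  refine ⟨?_, fun t => ?_, ?_, ?_, ?_⟩
  · exact eventually_probFilter_of_ae 1 fun n hn => Eventually.of_forall fun _ => by
      change n ≠ 0
      omega
  · have h := tendsto_integral_empirical hX_law hX_indep
      (h := (Iic t).indicator (1 : ℝ → ℝ)) (measurable_one.indicator measurableSet_Iic)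
      ((integrable_const (1 : ℝ)).indicator measurableSet_Iic)
    simpa only [integral_indicator_one measurableSet_Iic] using h
  · exact tendsto_integral_empirical hX_law hX_indep hφ.measurable.ereal_toReal
      (hφ.integrable_toReal husc)
  · exact eventually_probFilter_of_ae 2 hφhat
  · refine eventually_probFilter_of_ae 0 fun n _ => ?_
    refine ae_all_iff.2 fun j : Fin n => ?_
    have h1 : ∀ᵐ y ∂(law φ), y ∈ interior (dom φ) := by
      rw [ae_iff]
      exact law_compl_interior_dom hφ
    rw [← (hX_law j).map_eq] at h1
    exact ae_of_ae_map (hX_law j).aemeasurable h1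

end

theorem edist_zero_right_ennreal (a : ℝ≥0∞) : edist a 0 = a := by
  induction a with
  | top => exact (ENNReal.edist_eq_top_iff _ _).2 ⟨ENNReal.top_ne_zero, Or.inl rfl⟩
  | coe a =>
    change edist a 0 = (a : ℝ≥0∞)
    rw [edist_nndist, NNReal.nndist_zero_eq_val']

end

end LogConcaveTails

/-! ### The theorem -/

theorem theorem1
    {Ω : Type*} [MeasurableSpace Ω] (μ : Measure Ω) [IsProbabilityMeasure μ]
    (φ : ℝ → EReal)
    (hφ : LogConcaveTails.IsLogConcaveLogDensity φ)
    (hφ_usc : UpperSemicontinuous φ)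
    (X : ℕ → Ω → ℝ)
    (hX_law : ∀ i, HasLaw (X i) (LogConcaveTails.law φ) μ)
    (hX_indep : iIndepFun X μ)
    (φhat : ℕ → Ω → ℝ → EReal)
    (hφhat : ∀ n : ℕ, 2 ≤ n → ∀ᵐ ω ∂μ,
      LogConcaveTails.IsLogConcaveMLE (fun i : Fin n => X i ω) (φhat n ω)) :
    TendstoInMeasure μ
      (fun (n : ℕ) (ω : Ω) => ⨆ x : ℝ, (EReal.exp (φhat n ω x) - EReal.exp (φ x) : ℝ≥0∞))
      atTop (fun _ => 0) ∧
    ∀ b : ℕ → ℝ,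
      (∀ n, b n ∈ LogConcaveTails.cdfSupport (LogConcaveTails.law φ)) →
      Tendsto (fun n => (b n : EReal)) atTop
        (𝓝 (LogConcaveTails.rightEnd (LogConcaveTails.law φ))) →
      (⊥ < LogConcaveTails.derivLeftLim φ (LogConcaveTails.rightEnd (LogConcaveTails.law φ)) →
        ∀ ε : ℝ, 0 < ε →
          Tendsto (fun n : ℕ => μ {ω |
            LogConcaveTails.derivLeftLim φ (LogConcaveTails.rightEnd (LogConcaveTails.law φ))
                + (ε : EReal)
              < LogConcaveTails.estRightDeriv (fun i : Fin n => X i ω) (φhat n ω) (b n)})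
            atTop (𝓝 0)) ∧
      (LogConcaveTails.derivLeftLim φ (LogConcaveTails.rightEnd (LogConcaveTails.law φ)) = ⊥ →
        ∀ M : ℝ,
          Tendsto (fun n : ℕ => μ {ω |
            (M : EReal)
              ≤ LogConcaveTails.estRightDeriv (fun i : Fin n => X i ω) (φhat n ω) (b n)})
            atTop (𝓝 0)) := by
  have hconv := LogConcaveTails.empiricalConvergence_probFilter hφ hφ_usc hX_law hX_indep hφhat
  refine ⟨fun ε hε => ?_, fun b _ hb => ?_⟩
  · obtain ⟨δ, hδ0, hδε⟩ := ENNReal.lt_iff_exists_nnreal_btwn.1 hε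
    have hδ : (0 : ℝ) < δ := by exact_mod_cast hδ0
    refine LogConcaveTails.tendsto_measure_of_imp (hconv.eventually_exp_le hφ hφ_usc hδ)
      fun n ω hω h => ?_
    have hε' : ε ≤ ⨆ x : ℝ, (EReal.exp (φhat n ω x) - EReal.exp (φ x) : ℝ≥0∞) := by
      rw [← LogConcaveTails.edist_zero_right_ennreal (⨆ x : ℝ, _)]
      exact hω
    refine (hε'.trans (iSup_le fun x => ?_)).not_gt hδε
    rw [tsub_le_iff_left, ← ENNReal.ofReal_coe_nnreal]
    exact h x
  · set lam := LogConcaveTails.derivLeftLim φ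
      (LogConcaveTails.rightEnd (LogConcaveTails.law φ)) with hlam
    have key : ∀ s : ℝ, lam < s → ∀ᶠ q in LogConcaveTails.probFilter μ,
        LogConcaveTails.estRightDeriv (fun i : Fin q.1 => X i q.2) (φhat q.1 q.2) (b q.1) ≤ s := by
      intro s hs
      obtain ⟨d, hd, hev⟩ := hconv.eventually_estRightDeriv_le hφ hφ_usc hs
      have hbd := hb.eventually_const_lt (LogConcaveTails.coe_lt_rightEnd hφ hd)
      filter_upwards [hev, LogConcaveTails.tendsto_fst_probFilter.eventually hbd] with q hq hbq
      exact hq _ (EReal.coe_lt_coe_iff.1 hbq)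
    refine ⟨fun hbot ε hε => ?_, fun hbot M => ?_⟩
    -- If the limit slope were `⊤`, the event would be empty; this spares a proof that it is finite.
    · by_cases htop : lam = ⊤
      · simp [htop]
      have hcoe : (lam.toReal : EReal) = lam := EReal.coe_toReal htop hbot.ne'
      refine LogConcaveTails.tendsto_measure_of_imp (key (lam.toReal + ε / 2) ?_) fun n ω hω h => ?_
      · nth_rewrite 1 [← hcoe]
        exact EReal.coe_lt_coe_iff.2 (by linarith)
      · have h1 : lam + (ε : EReal) < ((lam.toReal + ε / 2 : ℝ) : EReal) := lt_of_lt_of_le hω h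
        rw [← hcoe, ← EReal.coe_add, EReal.coe_lt_coe_iff, EReal.toReal_coe] at h1
        linarith
    · refine LogConcaveTails.tendsto_measure_of_imp (key (M - 1) ?_) fun n ω hω h => ?_
      · rw [hbot]
        exact EReal.bot_lt_coe _
      · have h1 : (M : EReal) ≤ ((M - 1 : ℝ) : EReal) := le_trans hω h
        rw [EReal.coe_le_coe_iff] at h1
        linarith
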